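/- Let $p\in[1,2]$, $\alpha\in(0,1)$, $\gamma>1$, $k_0>0$ and $a_-,a_+,\lambda_-,\lambda_+>0$. Let $(\theta_{1,n})_{n\ge 0}$, $(\theta_{2,n})_{n\ge 0}$ be jointly independent copies of a real tempered stable random variable $\theta$ with characteristic function $$\mathbb E[e^{it\theta}]=\exp\Big(\int_{\mathbb R}\big(e^{itx}-1-i\kappa(x)tx\big)\,\lambda(dx)\Big),\qquad t\in\mathbb R,$$ where $\kappa(x)=\mathbf 1_{\{|x|<1\}}+|x|^{-1}\mathbf 1_{\{|x|\ge 1\}}$ and $$\lambda(dx)=a_-\frac{e^{-\lambda_-|x|}}{|x|^{1+\alpha}}\mathbf 1_{\{x<0\}}\,dx+a_+\frac{e^{-\lambda_+x}}{x^{1+\alpha}}\mathbf 1_{\{x>0\}}\,dx .$$ On the complex Banach space $E=\ell^p(\mathbb N)$ with canonical basis $(e_n)_{n\ge 0}$, let $T$ be the bounded weighted backward shift given by $Te_0=0$ and $Te_{n+1}=\omega_n e_n$ with $\omega_n=\big(\tfrac{n+2}{n+1}\big)^{\gamma/p}$, $n\ge 0$, and let $k_n=k_0\prod_{l=0}^{n-1}\omega_l^{-1}$.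 Then the series $\sum_{n\ge 0}k_n(\theta_{1,n}+i\theta_{2,n})e_n$ converges almost surely in $E$. Let $\mu$ be its distribution, and for $x^*,y^*\in E^*$ let $$C_\mu^=(x^*,y^*)=\log\int_E e^{i\,\mathrm{Re}\langle z,x^*-y^*\rangle}\mu(dz)-\log\int_E e^{i\,\mathrm{Re}\langle z,x^*\rangle}\mu(dz)-\log\int_E e^{-i\,\mathrm{Re}\langle z,y^*\rangle}\mu(dz)$$ be the codifference. Here $\log\int_E e^{iY}d\mu$ denotes the distinguished logarithm, i.e. the value at $t=1$ of the unique continuous $\psi:\mathbb R\to\mathbb C$ with $\psi(0)=0$ and $e^{\psi(t)}=\int_E e^{itY}d\mu$ for all $t$; it exists for all the functions $Y$ above. The operator $T$ admits $\mu$ as an invariant measure and is (strongly) mixing with respect to $\mu$, i.e. $\mu(A\cap T^{-n}B)\to\mu(A)\mu(B)$ for all Borel sets $A,B\subset E$. Moreover, writing $$K=2^{5-p}\big(a_-\lambda_-^{\alpha-p}+a_+\lambda_+^{\alpha-p}\big)\Gamma(p-\alpha)\,k_0^p$$ and $\mathrm B$ for the beta function, for all $n\ge 1$: $$\sup_{x^*,y^*\in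 E^*\setminus\{0\}}\frac{|C_\mu^=(x^*,T^{*n}y^*)|}{\|x^*\|^{p/2}\|y^*\|^{p/2}}\le \begin{cases}K\,\mathrm B\big(1-\tfrac\gamma2,\gamma-1\big)\,n^{-(\gamma-1)}, & 1<\gamma<2,\\[1ex] K\,\mathrm B\big(\tfrac\varepsilon2,1-\varepsilon\big)\,n^{-(1-\varepsilon)}\ \text{ for every }\varepsilon\in(0,1), & \gamma\ge 2.\end{cases}$$ -/

import Mathlib

open MeasureTheory ProbabilityTheory Filter Topology
open scoped ENNReal

/-- The complex sequence space `ℓ^p(ℕ)`. -/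
abbrev EllP (p : ℝ≥0∞) : Type := lp (fun _ : ℕ => ℂ) p

/-- The canonical basis vector `e_n` of `ℓ^p(ℕ)`. -/
noncomputable def basisVec (p : ℝ≥0∞) (n : ℕ) : EllP p := lp.single p n (1 : ℂ)

section Shift

variable {p : ℝ≥0∞} {w : ℕ → ℝ} {C : ℝ}

theorem shiftSeq_sum_le [Fact (1 ≤ p)] (hp : 0 < p.toReal) (hC : 0 ≤ C) (hw : ∀ n, |w n| ≤ C)
    (x : EllP p) (s : Finset ℕ) :
    ∑ n ∈ s, ‖(w n : ℂ) * x (n + 1)‖ ^ p.toReal ≤ (C * ‖x‖) ^ p.toReal := by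
  have h1 : ∀ n ∈ s, ‖(w n : ℂ) * x (n + 1)‖ ^ p.toReal
      ≤ C ^ p.toReal * ‖x (n + 1)‖ ^ p.toReal := by
    intro n _
    rw [← Real.mul_rpow hC (norm_nonneg _)]
    refine Real.rpow_le_rpow (norm_nonneg _) ?_ hp.le
    rw [norm_mul, Complex.norm_real, Real.norm_eq_abs]
    exact mul_le_mul_of_nonneg_right (hw n) (norm_nonneg _)
  refine (Finset.sum_le_sum h1).trans ?_
  rw [← Finset.mul_sum, Real.mul_rpow hC (norm_nonneg _)]
  refine mul_le_mul_of_nonneg_left ?_ (Real.rpow_nonneg hC _)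
  have h2 := lp.sum_rpow_le_norm_rpow hp x (s.map (addRightEmbedding 1))
  simpa using h2

theorem shiftSeq_norm_le [Fact (1 ≤ p)] (hC : 0 ≤ C) (hw : ∀ n, |w n| ≤ C) (x : EllP p) (n : ℕ) :
    ‖(w n : ℂ) * x (n + 1)‖ ≤ C * ‖x‖ := by
  have hp : p ≠ 0 := (lt_of_lt_of_le one_pos (Fact.out : 1 ≤ p)).ne'
  rw [norm_mul, Complex.norm_real, Real.norm_eq_abs]
  exact mul_le_mul (hw n) (lp.norm_apply_le_norm hp x _) (norm_nonneg _) hC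

theorem shiftSeq_memLp [Fact (1 ≤ p)] (hC : 0 ≤ C) (hw : ∀ n, |w n| ≤ C) (x : EllP p) :
    Memℓp (fun n => (w n : ℂ) * x (n + 1)) p := by
  rcases p.trichotomy with h | h | h
  · exact absurd h (lt_of_lt_of_le one_pos (Fact.out : 1 ≤ p)).ne'
  · subst h
    refine memℓp_infty ⟨C * ‖x‖, ?_⟩
    rintro _ ⟨n, rfl⟩
    exact shiftSeq_norm_le hC hw x n
  · exact memℓp_gen' (shiftSeq_sum_le h hC hw x)

/-- The bounded weighted backward shift `(Tx)_n = w_n x_{n+1}` on `ℓ^p(ℕ)`. -/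
noncomputable def weightedBackwardShift (p : ℝ≥0∞) [Fact (1 ≤ p)] (w : ℕ → ℝ) (C : ℝ)
    (hC : 0 ≤ C) (hw : ∀ n, |w n| ≤ C) : EllP p →L[ℂ] EllP p :=
  LinearMap.mkContinuous
    { toFun := fun x => ⟨fun n => (w n : ℂ) * x (n + 1), shiftSeq_memLp hC hw x⟩
      map_add' := fun x y => by
        ext n
        exact mul_add _ _ _
      map_smul' := fun c x => by
        ext n
        simp [mul_left_comm] }
    C (fun x => by
      rcases p.trichotomy with h | h | h
      · exact absurd h (lt_of_lt_of_le one_pos (Fact.out : 1 ≤ p)).ne'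
      · subst h
        exact lp.norm_le_of_forall_le (mul_nonneg hC (norm_nonneg _)) (shiftSeq_norm_le hC hw x)
      · exact lp.norm_le_of_forall_sum_le h (mul_nonneg hC (norm_nonneg _))
          (shiftSeq_sum_le h hC hw x))

theorem weightedBackwardShift_apply [Fact (1 ≤ p)] (hC : 0 ≤ C) (hw : ∀ n, |w n| ≤ C)
    (x : EllP p) (n : ℕ) :
    weightedBackwardShift p w C hC hw x n = (w n : ℂ) * x (n + 1) := rfl

theorem weightedBackwardShift_basisVec_zero [Fact (1 ≤ p)] (hC : 0 ≤ C) (hw : ∀ n, |w n| ≤ C) :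
    weightedBackwardShift p w C hC hw (basisVec p 0) = 0 := by
  ext n
  simp [weightedBackwardShift_apply, basisVec, lp.single_apply]

theorem weightedBackwardShift_basisVec_succ [Fact (1 ≤ p)] (hC : 0 ≤ C) (hw : ∀ n, |w n| ≤ C)
    (n : ℕ) :
    weightedBackwardShift p w C hC hw (basisVec p (n + 1)) = (w n : ℂ) • basisVec p n := by
  ext m
  rw [weightedBackwardShift_apply, lp.coeFn_smul, Pi.smul_apply, smul_eq_mul]
  by_cases h : m = n
  · subst h
    simp [basisVec, lp.single_apply]
  · simp [basisVec, lp.single_apply, h]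

end Shift

/-- The weights `ω_n = ((n+2)/(n+1))^{γ/p}`. -/
noncomputable def shiftWeight (γ p : ℝ) (n : ℕ) : ℝ := (((n : ℝ) + 2) / ((n : ℝ) + 1)) ^ (γ / p)

theorem abs_shiftWeight_le {γ p : ℝ} (hγ : 0 ≤ γ) (hp : 0 ≤ p) (n : ℕ) :
    |shiftWeight γ p n| ≤ 2 ^ (γ / p) := by
  have hn : (0 : ℝ) ≤ n := Nat.cast_nonneg n
  have h0 : (0 : ℝ) ≤ ((n : ℝ) + 2) / ((n : ℝ) + 1) := by positivity
  rw [shiftWeight, abs_of_nonneg (Real.rpow_nonneg h0 _)]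
  refine Real.rpow_le_rpow h0 ?_ (div_nonneg hγ hp)
  rw [div_le_iff₀ (by positivity)]
  linarith

/-- The bounded backward shift on `ℓ^p(ℕ)` with weights `((n+2)/(n+1))^{γ/p}`. -/
noncomputable def powerShift (p : ℝ≥0∞) [Fact (1 ≤ p)] (γ : ℝ) (hγ : 1 < γ) :
    EllP p →L[ℂ] EllP p :=
  weightedBackwardShift p (shiftWeight γ p.toReal) (2 ^ (γ / p.toReal))
    (Real.rpow_nonneg zero_le_two _) (abs_shiftWeight_le (zero_le_one.trans hγ.le) ENNReal.toReal_nonneg)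

/-- The coefficients `k_n = k_0 ∏_{l<n} 1/ω_l`. -/
noncomputable def shiftCoeff (γ p k₀ : ℝ) (n : ℕ) : ℝ :=
  k₀ * ∏ l ∈ Finset.range n, 1 / shiftWeight γ p l

/-- The density of the two-sided tempered stable Lévy measure. -/
noncomputable def temperedDensity (α aₙ aₚ lₙ lₚ x : ℝ) : ℝ :=
  if x < 0 then aₙ * Real.exp (-lₙ * |x|) / |x| ^ (1 + α)
  else if 0 < x then aₚ * Real.exp (-lₚ * x) / x ^ (1 + α)
  else 0

/-- The two-sided tempered stable Lévy measure on `ℝ`. -/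
noncomputable def temperedLevyMeasure (α aₙ aₚ lₙ lₚ : ℝ) : Measure ℝ :=
  volume.withDensity (fun x => ENNReal.ofReal (temperedDensity α aₙ aₚ lₙ lₚ x))

/-- The truncation function `κ(x) = 1` for `|x| < 1` and `1/|x|` for `|x| ≥ 1`. -/
noncomputable def truncation (x : ℝ) : ℝ := if |x| < 1 then 1 else 1 / |x|

/-- `ν` is the driftless two-sided tempered stable law: its characteristic function is
`exp (∫ (e^{itx} - 1 - i κ(x) t x) λ(dx))`. -/
def IsTemperedStable (α aₙ aₚ lₙ lₚ : ℝ) (ν : Measure ℝ) : Prop :=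
  IsProbabilityMeasure ν ∧ ∀ t : ℝ, charFun ν t =
    Complex.exp (∫ x, (Complex.exp (Complex.I * (t * x : ℝ)) - 1
      - Complex.I * (truncation x * t * x : ℝ)) ∂(temperedLevyMeasure α aₙ aₚ lₙ lₚ))

/-- The `n`-th term `k_n (θ_{1,n} + i θ_{2,n}) e_n` of the random series. -/
noncomputable def seriesTerm {Ω : Type*} (p : ℝ≥0∞) (k : ℕ → ℝ) (θ : Fin 2 → ℕ → Ω → ℝ)
    (ω : Ω) (n : ℕ) : EllP p :=
  ((k n : ℂ) * ((θ 0 n ω : ℂ) + Complex.I * (θ 1 n ω : ℂ))) • basisVec p n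

/-- The random series `∑_n k_n (θ_{1,n} + i θ_{2,n}) e_n` (and `0` where it diverges). -/
noncomputable def randomSeries {Ω : Type*} (p : ℝ≥0∞) [Fact (1 ≤ p)] (k : ℕ → ℝ)
    (θ : Fin 2 → ℕ → Ω → ℝ) (ω : Ω) : EllP p :=
  ∑' n, seriesTerm p k θ ω n

/-- Strong mixing of a measure-preserving map:
`μ(A ∩ T^{-n} B) → μ(A) μ(B)` for all measurable `A`, `B`. -/
def IsStronglyMixing {E : Type*} [MeasurableSpace E] (T : E → E) (μ : Measure E) : Prop :=
  MeasurePreserving T μ μ ∧ ∀ A B : Set E, MeasurableSet A → MeasurableSet B →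
    Tendsto (fun n : ℕ => μ (A ∩ (T^[n]) ⁻¹' B)) atTop (𝓝 (μ A * μ B))

/-- `ψ` is the distinguished logarithm of `φ`: the continuous function with `ψ(0) = 0` and
`exp ψ = φ`. For a nonvanishing characteristic function it exists, and for an infinitely divisible
law it is the Lévy-Khintchine exponent. -/
def IsDistinguishedLog (φ ψ : ℝ → ℂ) : Prop :=
  Continuous ψ ∧ ψ 0 = 0 ∧ ∀ t, Complex.exp (ψ t) = φ t

theorem IsDistinguishedLog.unique {φ ψ₁ ψ₂ : ℝ → ℂ} (h₁ : IsDistinguishedLog φ ψ₁)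
    (h₂ : IsDistinguishedLog φ ψ₂) : ψ₁ = ψ₂ := by
  obtain ⟨c₁, z₁, e₁⟩ := h₁
  obtain ⟨c₂, z₂, e₂⟩ := h₂
  have key : ∀ t, ∃ n : ℤ, ψ₁ t = ψ₂ t + n * (2 * Real.pi * Complex.I) := fun t =>
    Complex.exp_eq_exp_iff_exists_int.1 ((e₁ t).trans (e₂ t).symm)
  choose n hn using key
  have hpi : (2 * Real.pi * Complex.I : ℂ) ≠ 0 := Complex.two_pi_I_ne_zero
  have hdiv : ∀ t, (n t : ℂ) = (ψ₁ t - ψ₂ t) / (2 * Real.pi * Complex.I) := by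
    intro t
    rw [hn t]
    field_simp
    ring
  have hcont : Continuous fun t => ((n t : ℤ) : ℝ) := by
    have h : (fun t => ((n t : ℤ) : ℝ))
        = fun t => ((ψ₁ t - ψ₂ t) / (2 * Real.pi * Complex.I)).re := by
      funext t
      rw [← hdiv t]
      simp
    rw [h]
    exact Complex.continuous_re.comp ((c₁.sub c₂).div_const _)
  have hcn : Continuous n := by
    rw [Int.isClosedEmbedding_coe_real.isInducing.continuous_iff]
    exact hcont
  funext t
  have h0 : n 0 = 0 := by
    have := hdiv 0
    rw [z₁, z₂] at this
    simpa using this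
  have ht : n t = n 0 := PreconnectedSpace.constant inferInstance hcn
  rw [hn t, ht, h0]
  simp

open Classical in
/-- The distinguished logarithm of `φ` (and `0` if there is none). -/
noncomputable def distinguishedLog (φ : ℝ → ℂ) : ℝ → ℂ :=
  if h : ∃ ψ, IsDistinguishedLog φ ψ then h.choose else 0

theorem distinguishedLog_eq {φ ψ : ℝ → ℂ} (h : IsDistinguishedLog φ ψ) :
    distinguishedLog φ = ψ := by
  have hex : ∃ ψ, IsDistinguishedLog φ ψ := ⟨ψ, h⟩
  rw [distinguishedLog, dif_pos hex]
  exact hex.choose_spec.unique h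

/-- The characteristic function `t ↦ ∫ e^{i t Y} dμ` of a real function `Y` under `μ`. -/
noncomputable def realCharFun {E : Type*} [MeasurableSpace E] (μ : Measure E) (Y : E → ℝ)
    (t : ℝ) : ℂ :=
  ∫ z, Complex.exp (Complex.I * (t * Y z : ℝ)) ∂μ

/-- `log ∫ e^{i Y} dμ`, with the distinguished logarithm. -/
noncomputable def logIntegralExp {E : Type*} [MeasurableSpace E] (μ : Measure E) (Y : E → ℝ) : ℂ :=
  distinguishedLog (realCharFun μ Y) 1

/-- The codifference functional `C^=_μ(x^*, y^*)`. -/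
noncomputable def codifference {E : Type*} [NormedAddCommGroup E] [NormedSpace ℂ E]
    [MeasurableSpace E] (μ : Measure E) (x y : E →L[ℂ] ℂ) : ℂ :=
  logIntegralExp μ (fun z => ((x - y) z).re)
    - logIntegralExp μ (fun z => (x z).re)
    - logIntegralExp μ (fun z => -(y z).re)

/-!
Write `ψ` for the Lévy exponent and `ν` for the Lévy measure of the `θ_{j,n}`.

Near `0` the real part of `1 - exp ψ(t)` is `O(t ^ 2)`, so the `θ_{j,n}` have second moments, and
`∑ |k_n| ^ p < ∞` then gives the almost sure convergence. Since `k_{n+1} ω_n = k_n`, the operator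
`T` sends the sum of the series to the sum of the series with time shifted by one. Hence `(T, μ)` is
a factor of a Bernoulli shift, which gives the invariance of `μ` and the mixing.

The logarithm of the characteristic function of `Re ⟨·, x⟩` under `μ` is a sum of values of `ψ`, so
the codifference of `μ` is a sum of terms
`ψ(s - t) - ψ(s) - ψ(-t) = ∫ (e^{isu} - 1) (e^{-itu} - 1) ν(du)`, each of which the bound
`|e^{ia} - 1| ≤ 2 ^ (1 - p/2) |a| ^ (p/2)` controls by `|s| ^ (p/2) |t| ^ (p/2) ∫ |u| ^ p ν(du)`.
Composing `y` with `T ^ n` moves its coefficients `n` places along the sequence, and what remains is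
`∑_j (j+1) ^ (-γ/2) (j+1+n) ^ (-γ/2)`, which is at most the integral
`∫_0^∞ u ^ (-γ/2) (u+n) ^ (-γ/2) du = B(1 - γ/2, γ - 1) n ^ (-(γ - 1))`. For `γ ≥ 2` the same sum is
bounded with `2 - ε` in place of `γ`.
-/

/-! ### Lévy exponents -/

/-- The integrand of the Lévy–Khintchine formula with truncation function `κ`. -/
noncomputable def levyIntegrand (t x : ℝ) : ℂ :=
  Complex.exp (Complex.I * (t * x : ℝ)) - 1 - Complex.I * (_root_.truncation x * t * x : ℝ)

/-- The Lévy–Khintchine exponent of a Lévy measure `ν`, without drift and Gaussian part. -/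
noncomputable def levyExponent (ν : Measure ℝ) (t : ℝ) : ℂ :=
  ∫ x, levyIntegrand t x ∂ν

/-- `ρ` is the driftless infinitely divisible law with Lévy measure `ν` and no Gaussian part. -/
def HasLevyMeasure (ρ ν : Measure ℝ) : Prop :=
  IsProbabilityMeasure ρ ∧ ∀ t : ℝ, charFun ρ t = Complex.exp (levyExponent ν t)

theorem norm_exp_I_mul_ofReal_sub_one_le_rpow {q : ℝ} (hq₀ : 0 ≤ q) (hq₁ : q ≤ 1) (u : ℝ) :
    ‖Complex.exp (Complex.I * u) - 1‖ ≤ 2 ^ (1 - q) * |u| ^ q := by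
  have h_two : ‖Complex.exp (Complex.I * u) - 1‖ ≤ 2 := by
    rw [Complex.norm_exp_I_mul_ofReal_sub_one, norm_mul, Real.norm_two]
    linarith [Real.abs_sin_le_one (u / 2), Real.norm_eq_abs (Real.sin (u / 2))]
  have h_abs : ‖Complex.exp (Complex.I * u) - 1‖ ≤ |u| := Real.norm_exp_I_mul_ofReal_sub_one_le
  calc ‖Complex.exp (Complex.I * u) - 1‖
      = ‖Complex.exp (Complex.I * u) - 1‖ ^ (1 - q) * ‖Complex.exp (Complex.I * u) - 1‖ ^ q := by
        rw [← Real.rpow_add_of_nonneg (norm_nonneg _) (sub_nonneg.2 hq₁) hq₀, sub_add_cancel,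
          Real.rpow_one]
    _ ≤ 2 ^ (1 - q) * |u| ^ q := by
        have := sub_nonneg.2 hq₁
        gcongr

theorem measurable_truncation : Measurable _root_.truncation :=
  Measurable.ite (measurableSet_lt (by fun_prop) measurable_const) (by fun_prop) (by fun_prop)

theorem abs_truncation_le_one (x : ℝ) : |_root_.truncation x| ≤ 1 := by
  unfold _root_.truncation
  split_ifs with h
  · simp
  · rw [abs_of_nonneg (by positivity)]
    exact div_le_one_of_le₀ (not_lt.1 h) (abs_nonneg x)

theorem norm_levyIntegrand_sub_le (s t x : ℝ) :
    ‖levyIntegrand s x - levyIntegrand t x‖ ≤ 2 * |s - t| * |x| := by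
  have h_split : levyIntegrand s x - levyIntegrand t x
      = Complex.exp ((t * x : ℝ) * Complex.I)
          * (Complex.exp (Complex.I * ((s - t) * x : ℝ)) - 1)
        - Complex.I * (_root_.truncation x * ((s - t) * x) : ℝ) := by
    rw [levyIntegrand, levyIntegrand, mul_sub, ← Complex.exp_add]
    push_cast
    ring_nf
  have h_exp : ‖Complex.exp (Complex.I * ((s - t) * x : ℝ)) - 1‖ ≤ |(s - t) * x| :=
    Real.norm_exp_I_mul_ofReal_sub_one_le
  have h_drift : |_root_.truncation x| * |(s - t) * x| ≤ |(s - t) * x| :=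
    mul_le_of_le_one_left (abs_nonneg _) (abs_truncation_le_one x)
  calc ‖levyIntegrand s x - levyIntegrand t x‖
      ≤ ‖Complex.exp (Complex.I * ((s - t) * x : ℝ)) - 1‖
        + |_root_.truncation x| * |(s - t) * x| := by
        rw [h_split]
        refine (norm_sub_le _ _).trans_eq ?_
        rw [norm_mul, norm_mul, Complex.norm_exp_ofReal_mul_I, Complex.norm_I, Complex.norm_real,
          Real.norm_eq_abs, abs_mul, one_mul, one_mul]
    _ ≤ |(s - t) * x| + |(s - t) * x| := by gcongr
    _ = 2 * |s - t| * |x| := by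
        rw [abs_mul]
        ring

section Exponent

variable {ν : Measure ℝ}

theorem integrable_levyIntegrand (hν : Integrable (fun x : ℝ => |x|) ν) (t : ℝ) :
    Integrable (levyIntegrand t) ν := by
  have hm : Measurable (levyIntegrand t) := by
    have := measurable_truncation
    unfold levyIntegrand
    fun_prop
  refine (hν.const_mul (2 * |t|)).mono' hm.aestronglyMeasurable (Eventually.of_forall fun x => ?_)
  simpa [levyIntegrand] using norm_levyIntegrand_sub_le t 0 x

@[simp]
theorem levyExponent_zero : levyExponent ν 0 = 0 := by
  simp [levyExponent, levyIntegrand]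

theorem norm_levyExponent_sub_le (hν : Integrable (fun x : ℝ => |x|) ν) (s t : ℝ) :
    ‖levyExponent ν s - levyExponent ν t‖ ≤ (2 * ∫ x, |x| ∂ν) * |s - t| := by
  rw [levyExponent, levyExponent,
    ← integral_sub (integrable_levyIntegrand hν s) (integrable_levyIntegrand hν t)]
  refine (norm_integral_le_of_norm_le (hν.const_mul (2 * |s - t|))
    (Eventually.of_forall fun x => norm_levyIntegrand_sub_le s t x)).trans_eq ?_
  rw [integral_const_mul]
  ring

theorem lipschitzWith_levyExponent (hν : Integrable (fun x : ℝ => |x|) ν) :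
    LipschitzWith (2 * ∫ x, |x| ∂ν).toNNReal (levyExponent ν) :=
  LipschitzWith.of_dist_le' fun s t => by
    simpa only [dist_eq_norm, Real.norm_eq_abs] using norm_levyExponent_sub_le hν s t

theorem neg_re_levyExponent_le (hν : Integrable (fun x : ℝ => |x|) ν)
    (hν₂ : Integrable (fun x : ℝ => x ^ 2) ν) (t : ℝ) :
    -(levyExponent ν t).re ≤ (∫ x, x ^ 2 ∂ν) / 2 * t ^ 2 := by
  have h_re : (levyExponent ν t).re = ∫ x, (levyIntegrand t x).re ∂ν :=
    (integral_re (integrable_levyIntegrand hν t)).symm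
  have h_point : ∀ x, -(levyIntegrand t x).re ≤ t ^ 2 / 2 * x ^ 2 := fun x => by
    have h_cos := Real.one_sub_sq_div_two_le_cos (x := t * x)
    rw [levyIntegrand, mul_comm Complex.I, mul_comm Complex.I]
    simp only [Complex.sub_re, Complex.exp_ofReal_mul_I_re, Complex.one_re,
      Complex.re_ofReal_mul, Complex.I_re, mul_zero, sub_zero]
    linarith [mul_pow t x 2]
  calc -(levyExponent ν t).re = ∫ x, -(levyIntegrand t x).re ∂ν := by rw [h_re, integral_neg]
    _ ≤ ∫ x, t ^ 2 / 2 * x ^ 2 ∂ν :=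
        integral_mono (integrable_levyIntegrand hν t).re.neg (hν₂.const_mul _) h_point
    _ = (∫ x, x ^ 2 ∂ν) / 2 * t ^ 2 := by
        rw [integral_const_mul]
        ring

theorem levyIntegrand_codifference (s t x : ℝ) :
    levyIntegrand (s - t) x - levyIntegrand s x - levyIntegrand (-t) x
      = (Complex.exp (Complex.I * (s * x : ℝ)) - 1)
        * (Complex.exp (Complex.I * (-t * x : ℝ)) - 1) := by
  have h_exp : Complex.exp (Complex.I * ((s - t) * x : ℝ))
      = Complex.exp (Complex.I * (s * x : ℝ)) * Complex.exp (Complex.I * (-t * x : ℝ)) := by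
    rw [← Complex.exp_add]
    push_cast
    ring_nf
  rw [levyIntegrand, levyIntegrand, levyIntegrand, h_exp]
  push_cast
  ring

theorem norm_levyIntegrand_codifference_le {p : ℝ} (hp₀ : 0 ≤ p) (hp₂ : p ≤ 2) (s t x : ℝ) :
    ‖levyIntegrand (s - t) x - levyIntegrand s x - levyIntegrand (-t) x‖
      ≤ 2 ^ (2 - p) * (|s| ^ (p / 2) * |t| ^ (p / 2)) * |x| ^ p := by
  have h_factor := norm_exp_I_mul_ofReal_sub_one_le_rpow (q := p / 2) (by linarith) (by linarith)
  calc ‖levyIntegrand (s - t) x - levyIntegrand s x - levyIntegrand (-t) x‖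
      ≤ (2 ^ (1 - p / 2) * |s * x| ^ (p / 2)) * (2 ^ (1 - p / 2) * |-t * x| ^ (p / 2)) := by
        rw [levyIntegrand_codifference, norm_mul]
        gcongr <;> exact h_factor _
    _ = (2 ^ (1 - p / 2) * 2 ^ (1 - p / 2)) * (|s| ^ (p / 2) * |t| ^ (p / 2))
          * (|x| ^ (p / 2) * |x| ^ (p / 2)) := by
        rw [abs_mul, abs_mul, abs_neg, Real.mul_rpow (abs_nonneg _) (abs_nonneg _),
          Real.mul_rpow (abs_nonneg _) (abs_nonneg _)]
        ring
    _ = 2 ^ (2 - p) * (|s| ^ (p / 2) * |t| ^ (p / 2)) * |x| ^ p := by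
        rw [← Real.rpow_add two_pos, ← Real.rpow_add_of_nonneg (abs_nonneg x) (by linarith)
          (by linarith)]
        ring_nf

theorem norm_levyExponent_codifference_le (hν : Integrable (fun x : ℝ => |x|) ν) {p : ℝ}
    (hp₀ : 0 ≤ p) (hp₂ : p ≤ 2) (hp : Integrable (fun x : ℝ => |x| ^ p) ν) (s t : ℝ) :
    ‖levyExponent ν (s - t) - levyExponent ν s - levyExponent ν (-t)‖
      ≤ 2 ^ (2 - p) * (∫ x, |x| ^ p ∂ν) * (|s| ^ (p / 2) * |t| ^ (p / 2)) := by
  have h_int := integrable_levyIntegrand hν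
  calc ‖levyExponent ν (s - t) - levyExponent ν s - levyExponent ν (-t)‖
      = ‖∫ x, (levyIntegrand (s - t) x - levyIntegrand s x - levyIntegrand (-t) x) ∂ν‖ := by
        rw [integral_sub (f := fun x => levyIntegrand (s - t) x - levyIntegrand s x)
          ((h_int _).sub (h_int _)) (h_int _), integral_sub (h_int _) (h_int _)]
        rfl
    _ ≤ ∫ x, 2 ^ (2 - p) * (|s| ^ (p / 2) * |t| ^ (p / 2)) * |x| ^ p ∂ν :=
        norm_integral_le_of_norm_le (hp.const_mul _)
          (Eventually.of_forall (norm_levyIntegrand_codifference_le hp₀ hp₂ s t))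
    _ = 2 ^ (2 - p) * (∫ x, |x| ^ p ∂ν) * (|s| ^ (p / 2) * |t| ^ (p / 2)) := by
        rw [integral_const_mul]
        ring

end Exponent

/-! ### Second moments of laws with a given Lévy measure -/

theorem integrable_cos_mul {ρ : Measure ℝ} [IsFiniteMeasure ρ] (t : ℝ) :
    Integrable (fun x => Real.cos (t * x)) ρ :=
  .of_bound (by fun_prop) 1 (Eventually.of_forall fun x => Real.abs_cos_le_one (t * x))

theorem re_charFun_eq_integral_cos {ρ : Measure ℝ} [IsFiniteMeasure ρ] (t : ℝ) :
    (charFun ρ t).re = ∫ x, Real.cos (t * x) ∂ρ := by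
  have h_int : Integrable (fun x : ℝ => Complex.exp (t * x * Complex.I)) ρ :=
    .of_bound (by fun_prop) 1 (Eventually.of_forall fun x => by
      rw [← Complex.ofReal_mul, Complex.norm_exp_ofReal_mul_I])
  rw [charFun_apply_real, ← RCLike.re_eq_complex_re, ← integral_re h_int]
  simp only [← Complex.ofReal_mul, RCLike.re_eq_complex_re, Complex.exp_ofReal_mul_I_re]

theorem one_sub_re_exp_le {z : ℂ} (hz : z.re ≤ 0) :
    1 - (Complex.exp z).re ≤ -z.re + z.im ^ 2 / 2 := by
  have h_exp_le : Real.exp z.re ≤ 1 := Real.exp_le_one_iff.2 hz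
  have h_le_exp := Real.add_one_le_exp z.re
  have h_cos := Real.one_sub_sq_div_two_le_cos (x := z.im)
  rw [Complex.exp_re]
  nlinarith [Real.exp_pos z.re, Real.cos_le_one z.im]

theorem integrable_sq_of_integral_one_sub_cos_le {ρ : Measure ℝ} [IsFiniteMeasure ρ] {C : ℝ}
    (hC : ∀ t, ∫ x, (1 - Real.cos (t * x)) ∂ρ ≤ C * t ^ 2) :
    Integrable (fun x : ℝ => x ^ 2) ρ := by
  have h_cover : AECover ρ atTop fun n : ℕ => Set.Icc (-(n + 1 : ℝ)) (n + 1) :=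
    aecover_Icc
      (tendsto_neg_atTop_atBot.comp
        (tendsto_atTop_add_const_right _ 1 tendsto_natCast_atTop_atTop))
      (tendsto_atTop_add_const_right _ 1 tendsto_natCast_atTop_atTop)
  refine h_cover.integrable_of_integral_norm_bounded (Real.pi ^ 2 / 2 * C)
    (fun n => (by fun_prop : Continuous fun x : ℝ => x ^ 2).integrableOn_Icc)
    (Eventually.of_forall fun n => ?_)
  set t : ℝ := Real.pi / (n + 1) with ht
  have ht_pos : 0 < t := by positivity
  have h_int : Integrable (fun x => Real.pi ^ 2 / (2 * t ^ 2) * (1 - Real.cos (t * x))) ρ :=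
    ((integrable_const 1).sub (integrable_cos_mul t)).const_mul _
  have h_nonneg : ∀ x, 0 ≤ Real.pi ^ 2 / (2 * t ^ 2) * (1 - Real.cos (t * x)) := fun x =>
    mul_nonneg (by positivity) (sub_nonneg.2 (Real.cos_le_one _))
  have h_point : ∀ x ∈ Set.Icc (-(n + 1 : ℝ)) (n + 1),
      ‖x ^ 2‖ ≤ Real.pi ^ 2 / (2 * t ^ 2) * (1 - Real.cos (t * x)) := fun x hx => by
    have htx : |t * x| ≤ Real.pi := by
      rw [abs_mul, abs_of_pos ht_pos, ht, div_mul_eq_mul_div, div_le_iff₀ (by positivity)]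
      exact mul_le_mul_of_nonneg_left (abs_le.2 hx) Real.pi_pos.le
    have h_cos := Real.cos_le_one_sub_mul_cos_sq htx
    calc ‖x ^ 2‖ = Real.pi ^ 2 / (2 * t ^ 2) * (2 / Real.pi ^ 2 * (t * x) ^ 2) := by
          rw [Real.norm_of_nonneg (sq_nonneg x)]
          field_simp
      _ ≤ Real.pi ^ 2 / (2 * t ^ 2) * (1 - Real.cos (t * x)) := by
          gcongr
          linarith
  calc ∫ x in Set.Icc (-(n + 1 : ℝ)) (n + 1), ‖x ^ 2‖ ∂ρ
      ≤ ∫ x in Set.Icc (-(n + 1 : ℝ)) (n + 1),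
          Real.pi ^ 2 / (2 * t ^ 2) * (1 - Real.cos (t * x)) ∂ρ :=
        setIntegral_mono_on (by fun_prop : Continuous fun x : ℝ => ‖x ^ 2‖).integrableOn_Icc
          h_int.integrableOn measurableSet_Icc h_point
    _ ≤ Real.pi ^ 2 / (2 * t ^ 2) * ∫ x, (1 - Real.cos (t * x)) ∂ρ := by
        rw [← integral_const_mul]
        exact setIntegral_le_integral h_int (Eventually.of_forall h_nonneg)
    _ ≤ Real.pi ^ 2 / (2 * t ^ 2) * (C * t ^ 2) := by
        gcongr
        exact hC t
    _ = Real.pi ^ 2 / 2 * C := by field_simp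

theorem HasLevyMeasure.memLp_two {ρ ν : Measure ℝ} (hρ : HasLevyMeasure ρ ν)
    (hν : Integrable (fun x : ℝ => |x|) ν) (hν₂ : Integrable (fun x : ℝ => x ^ 2) ν) :
    MemLp id 2 ρ := by
  have := hρ.1
  refine (memLp_two_iff_integrable_sq aestronglyMeasurable_id).2
    (integrable_sq_of_integral_one_sub_cos_le
      (C := (∫ x, x ^ 2 ∂ν) / 2 + (2 * ∫ x, |x| ∂ν) ^ 2 / 2) fun t => ?_)
  have h_re : (levyExponent ν t).re ≤ 0 := by
    rw [← Real.exp_le_one_iff, ← Complex.norm_exp, ← hρ.2]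
    exact norm_charFun_le_one t
  have h_im : (levyExponent ν t).im ^ 2 ≤ (2 * ∫ x, |x| ∂ν) ^ 2 * t ^ 2 := by
    rw [← mul_pow, sq_le_sq, abs_mul, abs_of_nonneg (by positivity : 0 ≤ 2 * ∫ x, |x| ∂ν)]
    simpa using (Complex.abs_im_le_norm _).trans (norm_levyExponent_sub_le hν t 0)
  calc ∫ x, (1 - Real.cos (t * x)) ∂ρ = 1 - (Complex.exp (levyExponent ν t)).re := by
        rw [integral_sub (integrable_const _) (integrable_cos_mul t),
          ← re_charFun_eq_integral_cos, hρ.2, integral_const, probReal_univ, one_smul]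
    _ ≤ -(levyExponent ν t).re + (levyExponent ν t).im ^ 2 / 2 := one_sub_re_exp_le h_re
    _ ≤ ((∫ x, x ^ 2 ∂ν) / 2 + (2 * ∫ x, |x| ∂ν) ^ 2 / 2) * t ^ 2 := by
        linarith [neg_re_levyExponent_le hν hν₂ t]

/-! ### Gamma and beta integrals -/

theorem integrableOn_rpow_mul_exp_neg_mul_Ioi {a r : ℝ} (ha : 0 < a) (hr : 0 < r) :
    IntegrableOn (fun t : ℝ => t ^ (a - 1) * Real.exp (-(r * t))) (Set.Ioi 0) := by
  refine Integrable.of_integral_ne_zero ?_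
  rw [Real.integral_rpow_mul_exp_neg_mul_Ioi ha hr]
  have := Real.Gamma_pos_of_pos ha
  positivity

theorem lintegral_rpow_mul_exp_neg_mul_Ioi {a r : ℝ} (ha : 0 < a) (hr : 0 < r) :
    ∫⁻ t in Set.Ioi (0 : ℝ), ENNReal.ofReal (t ^ (a - 1) * Real.exp (-(r * t)))
      = ENNReal.ofReal (r ^ (-a) * Real.Gamma a) := by
  rw [← ofReal_integral_eq_lintegral_ofReal (integrableOn_rpow_mul_exp_neg_mul_Ioi ha hr),
    Real.integral_rpow_mul_exp_neg_mul_Ioi ha hr, one_div, Real.rpow_neg_eq_inv_rpow]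
  filter_upwards [self_mem_ae_restrict measurableSet_Ioi] with t (ht : 0 < t)
  change 0 ≤ t ^ (a - 1) * Real.exp (-(r * t))
  positivity

/-- Write `(u + c) ^ (-(a + b))` as a Gamma integral and integrate in `u` first. -/
theorem lintegral_rpow_mul_add_rpow_Ioi {a b c : ℝ} (ha : 0 < a) (hb : 0 < b) (hc : 0 < c) :
    ∫⁻ u in Set.Ioi (0 : ℝ), ENNReal.ofReal (u ^ (a - 1) * (u + c) ^ (-(a + b)))
      = ENNReal.ofReal (c ^ (-b) * beta a b) := by
  have hΓ : 0 < Real.Gamma (a + b) := Real.Gamma_pos_of_pos (add_pos ha hb)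
  let F : ℝ → ℝ → ℝ≥0∞ := fun u v =>
    ENNReal.ofReal (u ^ (a - 1) * (v ^ (a + b - 1) * Real.exp (-((u + c) * v))))
  have inner_v : ∀ u ∈ Set.Ioi (0 : ℝ), ∫⁻ v in Set.Ioi (0 : ℝ), F u v
      = ENNReal.ofReal (Real.Gamma (a + b))
        * ENNReal.ofReal (u ^ (a - 1) * (u + c) ^ (-(a + b))) := by
    intro u (hu : 0 < u)
    simp only [F, ENNReal.ofReal_mul (Real.rpow_nonneg hu.le _)]
    rw [lintegral_const_mul' _ _ ENNReal.ofReal_ne_top,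
      lintegral_rpow_mul_exp_neg_mul_Ioi (add_pos ha hb) (add_pos hu hc),
      ENNReal.ofReal_mul (by positivity)]
    ring
  have inner_u : ∀ v ∈ Set.Ioi (0 : ℝ), ∫⁻ u in Set.Ioi (0 : ℝ), F u v
      = ENNReal.ofReal (Real.Gamma a)
        * ENNReal.ofReal (v ^ (b - 1) * Real.exp (-(c * v))) := by
    intro v (hv : 0 < v)
    have h_split : ∀ u : ℝ, F u v = ENNReal.ofReal (v ^ (a + b - 1) * Real.exp (-(c * v)))
        * ENNReal.ofReal (u ^ (a - 1) * Real.exp (-(v * u))) := fun u => by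
      rw [← ENNReal.ofReal_mul (by positivity)]
      simp only [F, add_mul, neg_add, Real.exp_add]
      ring_nf
    simp only [h_split]
    rw [lintegral_const_mul' _ _ ENNReal.ofReal_ne_top, lintegral_rpow_mul_exp_neg_mul_Ioi ha hv,
      ← ENNReal.ofReal_mul (by positivity), ← ENNReal.ofReal_mul (Real.Gamma_pos_of_pos ha).le,
      show b - 1 = a + b - 1 + -a by ring, Real.rpow_add hv]
    ring_nf
  have h_swap : ENNReal.ofReal (Real.Gamma (a + b))
        * ∫⁻ u in Set.Ioi (0 : ℝ), ENNReal.ofReal (u ^ (a - 1) * (u + c) ^ (-(a + b)))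
      = ENNReal.ofReal (Real.Gamma a) * ENNReal.ofReal (c ^ (-b) * Real.Gamma b) := by
    rw [← lintegral_const_mul' _ _ ENNReal.ofReal_ne_top,
      ← setLIntegral_congr_fun measurableSet_Ioi inner_v, lintegral_lintegral_swap (by fun_prop),
      setLIntegral_congr_fun measurableSet_Ioi inner_u,
      lintegral_const_mul' _ _ ENNReal.ofReal_ne_top, lintegral_rpow_mul_exp_neg_mul_Ioi hb hc]
  refine (ENNReal.mul_right_inj (ENNReal.ofReal_pos.2 hΓ).ne' ENNReal.ofReal_ne_top).1 ?_
  rw [h_swap, ← ENNReal.ofReal_mul (Real.Gamma_pos_of_pos ha).le, ← ENNReal.ofReal_mul hΓ.le, beta]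
  congr 1
  field_simp

theorem tsum_natCast_add_one_le_lintegral_Ioi {f : ℝ → ℝ≥0∞} (hf : AntitoneOn f (Set.Ioi 0)) :
    ∑' j : ℕ, f (j + 1) ≤ ∫⁻ u in Set.Ioi (0 : ℝ), f u := by
  have h_piece : ∀ j : ℕ, f (j + 1) ≤ ∫⁻ u in Set.Ioc (j : ℝ) (j + 1), f u := fun j =>
    calc f (j + 1) = ∫⁻ _ in Set.Ioc (j : ℝ) (j + 1), f (j + 1) := by simp
      _ ≤ ∫⁻ u in Set.Ioc (j : ℝ) (j + 1), f u :=
        setLIntegral_mono' measurableSet_Ioc fun u hu =>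
          hf ((Nat.cast_nonneg j).trans_lt hu.1) (by positivity : (0 : ℝ) < j + 1) hu.2
  have h_disj : Pairwise (Function.onFun Disjoint fun j : ℕ => Set.Ioc (j : ℝ) (j + 1)) :=
    fun i j hij => by
      simpa [Function.onFun] using Set.pairwise_disjoint_Ioc_intCast ℝ (Nat.cast_injective.ne hij)
  calc ∑' j : ℕ, f (j + 1) ≤ ∑' j : ℕ, ∫⁻ u in Set.Ioc (j : ℝ) (j + 1), f u :=
        ENNReal.tsum_le_tsum h_piece
    _ = ∫⁻ u in ⋃ j : ℕ, Set.Ioc (j : ℝ) (j + 1), f u :=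
        (lintegral_iUnion (fun _ => measurableSet_Ioc) h_disj f).symm
    _ ≤ ∫⁻ u in Set.Ioi (0 : ℝ), f u :=
        lintegral_mono_set (Set.iUnion_subset fun j _ hu => (Nat.cast_nonneg j).trans_lt hu.1)

theorem sum_rpow_mul_add_rpow_le_beta {a b c : ℝ} (ha : 0 < a) (ha₁ : a ≤ 1) (hb : 0 < b)
    (hc : 0 < c) (N : ℕ) :
    ∑ j ∈ Finset.range N, ((j : ℝ) + 1) ^ (a - 1) * ((j : ℝ) + 1 + c) ^ (-(a + b))
      ≤ c ^ (-b) * beta a b := by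
  let f : ℝ → ℝ≥0∞ := fun u => ENNReal.ofReal (u ^ (a - 1) * (u + c) ^ (-(a + b)))
  have h_anti : AntitoneOn f (Set.Ioi 0) := fun u (hu : 0 < u) v (hv : 0 < v) huv =>
    ENNReal.ofReal_le_ofReal <| mul_le_mul
      (Real.rpow_le_rpow_of_nonpos hu huv (by linarith))
      (Real.rpow_le_rpow_of_nonpos (by positivity) (by linarith) (by linarith))
      (by positivity) (by positivity)
  have h_beta := beta_pos ha hb
  rw [← ENNReal.ofReal_le_ofReal_iff (by positivity),
    ENNReal.ofReal_sum_of_nonneg fun j _ => by positivity]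
  calc ∑ j ∈ Finset.range N, f (j + 1) ≤ ∑' j : ℕ, f (j + 1) := ENNReal.sum_le_tsum _
    _ ≤ ∫⁻ u in Set.Ioi (0 : ℝ), f u := tsum_natCast_add_one_le_lintegral_Ioi h_anti
    _ = ENNReal.ofReal (c ^ (-b) * beta a b) := lintegral_rpow_mul_add_rpow_Ioi ha hb hc

/-! ### Moments of the tempered stable Lévy measure -/

section TemperedMoments

variable {α aₙ aₚ lₙ lₚ : ℝ}

theorem measurable_temperedDensity : Measurable (temperedDensity α aₙ aₚ lₙ lₚ) :=
  Measurable.ite measurableSet_Iio (by fun_prop)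
    (Measurable.ite measurableSet_Ioi (by fun_prop) measurable_const)

theorem temperedDensity_nonneg (haₙ : 0 ≤ aₙ) (haₚ : 0 ≤ aₚ) (x : ℝ) :
    0 ≤ temperedDensity α aₙ aₚ lₙ lₚ x := by
  unfold temperedDensity
  split_ifs <;> positivity

theorem temperedDensity_neg (x : ℝ) :
    temperedDensity α aₙ aₚ lₙ lₚ (-x) = temperedDensity α aₚ aₙ lₚ lₙ x := by
  unfold temperedDensity
  rcases lt_trichotomy x 0 with hx | rfl | hx
  · simp [hx, hx.not_gt, abs_of_neg hx]
  · simp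
  · simp [hx, hx.not_gt, abs_of_pos hx]

theorem temperedDensity_mul_abs_rpow_of_pos {x : ℝ} (hx : 0 < x) (q : ℝ) :
    temperedDensity α aₙ aₚ lₙ lₚ x * |x| ^ q
      = aₚ * (x ^ (q - α - 1) * Real.exp (-(lₚ * x))) := by
  rw [temperedDensity, if_neg hx.not_gt, if_pos hx, abs_of_pos hx,
    show q - α - 1 = q - (1 + α) by ring, Real.rpow_sub hx, neg_mul]
  ring

theorem integrableOn_temperedDensity_mul_abs_rpow_Ioi (hlₚ : 0 < lₚ) {q : ℝ} (hq : α < q) :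
    IntegrableOn (fun x => temperedDensity α aₙ aₚ lₙ lₚ x * |x| ^ q) (Set.Ioi 0) :=
  IntegrableOn.congr_fun ((integrableOn_rpow_mul_exp_neg_mul_Ioi (sub_pos.2 hq) hlₚ).const_mul aₚ)
    (fun _ hx => (temperedDensity_mul_abs_rpow_of_pos hx q).symm) measurableSet_Ioi

theorem integrableOn_temperedDensity_mul_abs_rpow_Iic (hlₙ : 0 < lₙ) {q : ℝ} (hq : α < q) :
    IntegrableOn (fun x => temperedDensity α aₙ aₚ lₙ lₚ x * |x| ^ q) (Set.Iic 0) := by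
  rw [integrableOn_Iic_iff_integrableOn_Iio]
  have h_refl :
      IntegrableOn (fun x => temperedDensity α aₚ aₙ lₚ lₙ x * |x| ^ q) (Set.Ioi (-0)) := by
    simpa only [neg_zero] using integrableOn_temperedDensity_mul_abs_rpow_Ioi hlₙ hq
  simpa only [temperedDensity_neg, abs_neg] using h_refl.comp_neg_Iio

theorem setIntegral_temperedDensity_mul_abs_rpow_Ioi (hlₚ : 0 < lₚ) {q : ℝ} (hq : α < q) :
    ∫ x in Set.Ioi 0, temperedDensity α aₙ aₚ lₙ lₚ x * |x| ^ q
      = aₚ * lₚ ^ (α - q) * Real.Gamma (q - α) := by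
  rw [setIntegral_congr_fun measurableSet_Ioi fun _ hx => temperedDensity_mul_abs_rpow_of_pos hx q,
    integral_const_mul, Real.integral_rpow_mul_exp_neg_mul_Ioi (sub_pos.2 hq) hlₚ, one_div,
    ← Real.rpow_neg_eq_inv_rpow, neg_sub, mul_assoc]

theorem setIntegral_temperedDensity_mul_abs_rpow_Iic (hlₙ : 0 < lₙ) {q : ℝ} (hq : α < q) :
    ∫ x in Set.Iic 0, temperedDensity α aₙ aₚ lₙ lₚ x * |x| ^ q
      = aₙ * lₙ ^ (α - q) * Real.Gamma (q - α) := by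
  have h_refl := integral_comp_neg_Ioi 0 fun x => temperedDensity α aₙ aₚ lₙ lₚ x * |x| ^ q
  simp only [temperedDensity_neg, abs_neg, neg_zero] at h_refl
  rw [← h_refl, setIntegral_temperedDensity_mul_abs_rpow_Ioi hlₙ hq]

theorem integrable_abs_rpow_temperedLevyMeasure (haₙ : 0 ≤ aₙ) (haₚ : 0 ≤ aₚ) (hlₙ : 0 < lₙ)
    (hlₚ : 0 < lₚ) {q : ℝ} (hq : α < q) :
    Integrable (fun x : ℝ => |x| ^ q) (temperedLevyMeasure α aₙ aₚ lₙ lₚ) := by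
  rw [temperedLevyMeasure, integrable_withDensity_iff_integrable_smul'
    measurable_temperedDensity.ennreal_ofReal (Eventually.of_forall fun _ => ENNReal.ofReal_lt_top)]
  simp only [ENNReal.toReal_ofReal (temperedDensity_nonneg haₙ haₚ _), smul_eq_mul]
  rw [← integrableOn_univ, ← Set.Iic_union_Ioi (a := (0 : ℝ))]
  exact (integrableOn_temperedDensity_mul_abs_rpow_Iic hlₙ hq).union
    (integrableOn_temperedDensity_mul_abs_rpow_Ioi hlₚ hq)

theorem integrable_abs_temperedLevyMeasure (haₙ : 0 ≤ aₙ) (haₚ : 0 ≤ aₚ) (hlₙ : 0 < lₙ)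
    (hlₚ : 0 < lₚ) (hα : α < 1) :
    Integrable (fun x : ℝ => |x|) (temperedLevyMeasure α aₙ aₚ lₙ lₚ) := by
  simpa only [Real.rpow_one] using integrable_abs_rpow_temperedLevyMeasure haₙ haₚ hlₙ hlₚ hα

theorem integrable_sq_temperedLevyMeasure (haₙ : 0 ≤ aₙ) (haₚ : 0 ≤ aₚ) (hlₙ : 0 < lₙ)
    (hlₚ : 0 < lₚ) (hα : α < 2) :
    Integrable (fun x : ℝ => x ^ 2) (temperedLevyMeasure α aₙ aₚ lₙ lₚ) := by
  simpa only [Real.rpow_two, sq_abs] using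
    integrable_abs_rpow_temperedLevyMeasure haₙ haₚ hlₙ hlₚ hα

theorem integral_abs_rpow_temperedLevyMeasure (haₙ : 0 ≤ aₙ) (haₚ : 0 ≤ aₚ) (hlₙ : 0 < lₙ)
    (hlₚ : 0 < lₚ) {q : ℝ} (hq : α < q) :
    ∫ x, |x| ^ q ∂(temperedLevyMeasure α aₙ aₚ lₙ lₚ)
      = (aₙ * lₙ ^ (α - q) + aₚ * lₚ ^ (α - q)) * Real.Gamma (q - α) := by
  rw [temperedLevyMeasure, integral_withDensity_eq_integral_toReal_smul
    measurable_temperedDensity.ennreal_ofReal (Eventually.of_forall fun _ => ENNReal.ofReal_lt_top)]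
  simp only [ENNReal.toReal_ofReal (temperedDensity_nonneg haₙ haₚ _), smul_eq_mul]
  rw [← intervalIntegral.integral_Iic_add_Ioi (b := 0)
    (integrableOn_temperedDensity_mul_abs_rpow_Iic hlₙ hq)
    (integrableOn_temperedDensity_mul_abs_rpow_Ioi hlₚ hq),
    setIntegral_temperedDensity_mul_abs_rpow_Iic hlₙ hq,
    setIntegral_temperedDensity_mul_abs_rpow_Ioi hlₚ hq]
  ring

end TemperedMoments

/-! ### Strong mixing of Bernoulli shifts and their factors -/

theorem tendsto_measure_inter_of_isPiSystem {Z : Type*} [mZ : MeasurableSpace Z] {Q : Measure Z}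
    [IsProbabilityMeasure Q] {S : Set (Set Z)} (hS : mZ = MeasurableSpace.generateFrom S)
    (hS_pi : IsPiSystem S) {B : ℕ → Set Z} (hB : ∀ n, MeasurableSet (B n)) {b : ℝ≥0∞}
    (hQB : ∀ n, Q (B n) = b)
    (h : ∀ A ∈ S, Tendsto (fun n => Q (A ∩ B n)) atTop (𝓝 (Q A * b)))
    {A : Set Z} (hA : MeasurableSet A) :
    Tendsto (fun n => Q (A ∩ B n)) atTop (𝓝 (Q A * b)) := by
  induction A, hA using MeasurableSpace.induction_on_inter hS hS_pi with
  | empty => simp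
  | basic A hA => exact h A hA
  | compl A hA ih =>
    have hb : b ≠ ∞ := hQB 0 ▸ measure_ne_top _ _
    have h_compl : ∀ n, Q (Aᶜ ∩ B n) = b - Q (A ∩ B n) := fun n => by
      refine ENNReal.eq_sub_of_add_eq (measure_ne_top _ _) ?_
      rw [← hQB n, Set.inter_comm, Set.inter_comm A, ← Set.sdiff_eq, add_comm,
        measure_inter_add_sdiff _ hA]
    simp only [h_compl]
    rw [prob_compl_eq_one_sub hA, ENNReal.sub_mul fun _ _ => hb, one_mul]
    exact ENNReal.Tendsto.sub tendsto_const_nhds ih (Or.inl hb)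
  | iUnion f hd hf ih =>
    have h_union : ∀ n, Q ((⋃ i, f i) ∩ B n) = ∫⁻ i, Q (f i ∩ B n) ∂Measure.count := fun n => by
      rw [lintegral_count, Set.iUnion_inter, measure_iUnion
        (fun i j hij => (hd hij).mono Set.inter_subset_left Set.inter_subset_left)
        fun i => (hf i).inter (hB n)]
    have h_total : ∫⁻ i, Q (f i) ∂Measure.count = Q (⋃ i, f i) := by
      rw [lintegral_count, measure_iUnion hd hf]
    simp only [h_union]
    rw [measure_iUnion hd hf, ← ENNReal.tsum_mul_right, ← lintegral_count]
    exact tendsto_lintegral_of_dominated_convergence (fun i => Q (f i))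
      (fun _ => measurable_of_countable _)
      (fun n => Eventually.of_forall fun i => measure_mono Set.inter_subset_left)
      (h_total ▸ measure_ne_top _ _) (Eventually.of_forall ih)

/-- The shift of the time coordinate on families indexed by `J × ℕ`; on an infinite product of one
probability measure it is a Bernoulli shift. -/
def coordShift {J S : Type*} (z : J × ℕ → S) : J × ℕ → S := fun i => z (i.1, i.2 + 1)

theorem coordShift_iterate {J S : Type*} (n : ℕ) (z : J × ℕ → S) :
    coordShift^[n] z = fun i => z (i.1, i.2 + n) := by
  induction n generalizing z with
  | zero => rfl
  | succ n ih =>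
    rw [Function.iterate_succ_apply, ih]
    funext i
    simp only [coordShift, add_assoc]

section Bernoulli

variable {J S : Type*} [MeasurableSpace S] {ρ : Measure S} [IsProbabilityMeasure ρ]

theorem measurePreserving_coordShift :
    MeasurePreserving (coordShift (J := J) (S := S)) (Measure.infinitePi fun _ => ρ)
      (Measure.infinitePi fun _ => ρ) := by
  refine ⟨by unfold coordShift; fun_prop, ?_⟩
  have h_inj : Function.Injective fun i : J × ℕ => (i.1, i.2 + 1) := fun i j hij => by
    simpa [Prod.ext_iff] using hij
  exact Measure.map_infinitePi_infinitePi_of_inj (P := fun _ : J × ℕ => ρ) h_inj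

theorem measure_cylinder_inter_coordShift_preimage {s : Finset (J × ℕ)} {A : Set (s → S)}
    (hA : MeasurableSet A) {B : Set (J × ℕ → S)} (hB : MeasurableSet B) {n : ℕ}
    (hn : ∀ i ∈ s, i.2 < n) :
    (Measure.infinitePi fun _ : J × ℕ => ρ) (cylinder s A ∩ coordShift^[n] ⁻¹' B)
      = (Measure.infinitePi fun _ => ρ) (cylinder s A) * (Measure.infinitePi fun _ => ρ) B := by
  let m : J × ℕ → MeasurableSpace (J × ℕ → S) := fun i =>
    MeasurableSpace.comap (fun z => z i) inferInstance
  have h_indep : iIndep m (Measure.infinitePi fun _ : J × ℕ => ρ) :=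
    iIndepFun_infinitePi (P := fun _ : J × ℕ => ρ) (X := fun _ x => x) fun _ => measurable_id
  have h_disj : Disjoint (↑s : Set (J × ℕ)) {i | n ≤ i.2} :=
    Set.disjoint_left.2 fun i hi => not_le.2 (hn i hi)
  have h_past : Measurable[⨆ i ∈ (↑s : Set (J × ℕ)), m i]
      (s.restrict : (J × ℕ → S) → s → S) :=
    @measurable_pi_lambda _ _ _ (_) _ _ fun i =>
      (comap_measurable (fun z : J × ℕ → S => z i)).mono
        (le_iSup₂_of_le (i : J × ℕ) i.2 le_rfl) le_rfl
  have h_future : Measurable[⨆ i ∈ {i : J × ℕ | n ≤ i.2}, m i]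
      (coordShift (J := J) (S := S))^[n] := by
    refine @measurable_pi_lambda _ _ _ (_) _ _ fun i => ?_
    simp only [coordShift_iterate]
    exact (comap_measurable (fun z : J × ℕ → S => z (i.1, i.2 + n))).mono
      (le_iSup₂_of_le (i.1, i.2 + n) (Nat.le_add_left _ _) le_rfl) le_rfl
  rw [cylinder, (Indep_iff _ _ _).1 (indep_iSup_of_disjoint
      (fun i => (measurable_pi_apply i).comap_le) h_indep h_disj) _ _ (h_past hA) (h_future hB),
    (measurePreserving_coordShift.iterate n).measure_preimage hB.nullMeasurableSet]

theorem isStronglyMixing_coordShift :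
    IsStronglyMixing (coordShift (J := J) (S := S)) (Measure.infinitePi fun _ => ρ) := by
  have h_iter := (measurePreserving_coordShift (J := J) (ρ := ρ)).iterate
  refine ⟨measurePreserving_coordShift, fun A B hA hB => ?_⟩
  refine tendsto_measure_inter_of_isPiSystem
    (generateFrom_measurableCylinders (α := fun _ : J × ℕ => S)).symm isPiSystem_measurableCylinders
    (fun n => (h_iter n).measurable hB)
    (fun n => (h_iter n).measure_preimage hB.nullMeasurableSet) (fun A hA => ?_) hA
  obtain ⟨s, C, hC, rfl⟩ := (mem_measurableCylinders _).1 hA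
  refine tendsto_const_nhds.congr' ?_
  filter_upwards [eventually_gt_atTop (s.sup fun i => i.2)] with n hn
  exact (measure_cylinder_inter_coordShift_preimage hC hB
    fun i hi => (Finset.le_sup (f := fun i : J × ℕ => i.2) hi).trans_lt hn).symm

end Bernoulli

theorem ae_iterate_apply_eq_of_ae_semiconj {Z E : Type*} [MeasurableSpace Z] {σ : Z → Z}
    {Q : Measure Z} {T : E → E} {G : Z → E} (hσ : Measure.QuasiMeasurePreserving σ Q Q)
    (h : ∀ᵐ z ∂Q, T (G z) = G (σ z)) (n : ℕ) :
    ∀ᵐ z ∂Q, T^[n] (G z) = G (σ^[n] z) := by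
  induction n with
  | zero => simp
  | succ n ih =>
    filter_upwards [h, hσ.ae ih] with z h_one h_iter
    rw [Function.iterate_succ_apply, h_one, h_iter, Function.iterate_succ_apply]

section Factor

variable {Z E : Type*} [MeasurableSpace Z] [MeasurableSpace E] {σ : Z → Z} {Q : Measure Z}
  {T : E → E} {G : Z → E}

theorem IsStronglyMixing.map_of_measurable (hσ : IsStronglyMixing σ Q) (hT : Measurable T)
    (hG : Measurable G) (h : ∀ᵐ z ∂Q, T (G z) = G (σ z)) : IsStronglyMixing T (Q.map G) := by
  refine ⟨⟨hT, ?_⟩, fun A B hA hB => ?_⟩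
  · rw [Measure.map_map hT hG, Measure.map_congr (f := T ∘ G) (g := G ∘ σ) h,
      ← Measure.map_map hG hσ.1.measurable, hσ.1.map_eq]
  · have h_inter : ∀ n : ℕ, (Q.map G) (A ∩ T^[n] ⁻¹' B)
        = Q (G ⁻¹' A ∩ σ^[n] ⁻¹' (G ⁻¹' B)) := fun n => by
      rw [Measure.map_apply hG (hA.inter (hT.iterate n hB))]
      refine measure_congr ?_
      filter_upwards [ae_iterate_apply_eq_of_ae_semiconj hσ.1.quasiMeasurePreserving h n] with z hz
      exact congrArg (fun e => G z ∈ A ∧ e ∈ B) hz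
    simp only [h_inter]
    rw [Measure.map_apply hG hA, Measure.map_apply hG hB]
    exact hσ.2 _ _ (hG hA) (hG hB)

theorem IsStronglyMixing.map (hσ : IsStronglyMixing σ Q) (hT : Measurable T)
    (hG : AEMeasurable G Q) (h : ∀ᵐ z ∂Q, T (G z) = G (σ z)) : IsStronglyMixing T (Q.map G) := by
  rw [Measure.map_congr hG.ae_eq_mk]
  refine hσ.map_of_measurable hT hG.measurable_mk ?_
  filter_upwards [h, hG.ae_eq_mk, hσ.1.quasiMeasurePreserving.ae hG.ae_eq_mk] with z hz hz₁ hz₂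
  rw [← hz₁, ← hz₂, hz]

end Factor

/-! ### The random series -/

section Coefficients

variable {γ p k₀ : ℝ}

theorem shiftWeight_pos (n : ℕ) : 0 < shiftWeight γ p n := by
  unfold shiftWeight
  positivity

theorem shiftCoeff_succ_mul (n : ℕ) :
    shiftCoeff γ p k₀ (n + 1) * shiftWeight γ p n = shiftCoeff γ p k₀ n := by
  have hw := (shiftWeight_pos (γ := γ) (p := p) n).ne'
  rw [shiftCoeff, Finset.prod_range_succ, shiftCoeff]
  field_simp

theorem shiftCoeff_eq (n : ℕ) : shiftCoeff γ p k₀ n = k₀ * ((n : ℝ) + 1) ^ (-(γ / p)) := by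
  induction n with
  | zero => simp [shiftCoeff]
  | succ n ih =>
    rw [← mul_left_inj' (shiftWeight_pos (γ := γ) (p := p) n).ne', shiftCoeff_succ_mul, ih,
      shiftWeight, Real.div_rpow (by positivity) (by positivity), Real.rpow_neg (by positivity),
      Real.rpow_neg (by positivity)]
    push_cast
    rw [show (n : ℝ) + 1 + 1 = n + 2 by ring]
    field_simp

theorem shiftCoeff_pos (hk₀ : 0 < k₀) (n : ℕ) : 0 < shiftCoeff γ p k₀ n := by
  rw [shiftCoeff_eq]
  positivity

theorem shiftCoeff_rpow (hk₀ : 0 ≤ k₀) (n : ℕ) (q : ℝ) :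
    shiftCoeff γ p k₀ n ^ q = k₀ ^ q * ((n : ℝ) + 1) ^ (-(γ / p) * q) := by
  rw [shiftCoeff_eq, Real.mul_rpow hk₀ (by positivity), ← Real.rpow_mul (by positivity)]

theorem summable_shiftCoeff_rpow (hk₀ : 0 < k₀) (hp : 0 < p) (hγ : 1 < γ) :
    Summable fun n => |shiftCoeff γ p k₀ n| ^ p := by
  have h_term : ∀ n, |shiftCoeff γ p k₀ n| ^ p = k₀ ^ p * (((n + 1 : ℕ) : ℝ) ^ (-γ)) := fun n => by
    rw [abs_of_pos (shiftCoeff_pos hk₀ n), shiftCoeff_rpow hk₀.le, neg_mul,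
      div_mul_cancel₀ _ hp.ne', Nat.cast_add_one]
  simp only [h_term]
  exact ((summable_nat_add_iff (f := fun n : ℕ => (n : ℝ) ^ (-γ)) 1).2
    (Real.summable_nat_rpow.2 (neg_lt_neg hγ))).mul_left _

end Coefficients

section RandomSeries

variable {Ω : Type*} [MeasurableSpace Ω] {P : Measure Ω} {p : ℝ≥0∞} [Fact (1 ≤ p)] {k : ℕ → ℝ}
  {θ : Fin 2 → ℕ → Ω → ℝ}

theorem norm_basisVec (n : ℕ) : ‖basisVec p n‖ = 1 := by
  rw [basisVec, lp.norm_single (zero_lt_one.trans_le Fact.out), norm_one]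

theorem summable_smul_basisVec (hp : p ≠ ∞) {c : ℕ → ℂ}
    (hc : Summable fun n => ‖c n‖ ^ p.toReal) : Summable fun n => c n • basisVec p n := by
  refine (lp.hasSum_single hp (⟨c, memℓp_gen hc⟩ : EllP p)).summable.congr fun n => ?_
  rw [basisVec, ← lp.single_smul, smul_eq_mul, mul_one]

theorem ae_summable_smul_basisVec (hp : p ≠ ∞) {ξ : ℕ → Ω → ℂ}
    (hξ : ∀ n, AEMeasurable (ξ n) P) (h : ∑' n, eLpNorm (ξ n) p P ^ p.toReal ≠ ∞) :
    ∀ᵐ ω ∂P, Summable fun n => ξ n ω • basisVec p n := by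
  have hp₀ : p ≠ 0 := (zero_lt_one.trans_le Fact.out).ne'
  have h_lintegral : ∫⁻ ω, ∑' n, ‖ξ n ω‖ₑ ^ p.toReal ∂P ≠ ∞ := by
    rw [lintegral_tsum fun n => (hξ n).enorm.pow_const _]
    simpa only [eLpNorm_eq_lintegral_rpow_enorm_toReal hp₀ hp, one_div,
      ENNReal.rpow_inv_rpow (ENNReal.toReal_pos hp₀ hp).ne'] using h
  have h_meas : AEMeasurable (fun ω => ∑' n, ‖ξ n ω‖ₑ ^ p.toReal) P :=
    AEMeasurable.tsum fun n => (hξ n).enorm.pow_const _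
  filter_upwards [ae_lt_top' h_meas h_lintegral] with ω hω
  refine summable_smul_basisVec hp ((ENNReal.summable_toReal hω.ne).congr fun n => ?_)
  rw [← ENNReal.toReal_rpow, toReal_enorm]

theorem ae_summable_seriesTerm (hp : p ≠ ∞) (hk : Summable fun n => |k n| ^ p.toReal)
    {ρ : Measure ℝ} (hρ : MemLp id p ρ) (hθ : ∀ j n, IdentDistrib (θ j n) id P ρ) :
    ∀ᵐ ω ∂P, Summable (seriesTerm p k θ ω) := by
  set M := eLpNorm id p ρ + eLpNorm id p ρ with hM
  have hp₁ : 1 ≤ p := Fact.out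
  have hp₀ : 0 ≤ p.toReal := ENNReal.toReal_nonneg
  have h_meas : ∀ j n, AEStronglyMeasurable (fun ω => (θ j n ω : ℂ)) P := fun j n =>
    (Complex.measurable_ofReal.comp_aemeasurable (hθ j n).aemeasurable_fst).aestronglyMeasurable
  have h_eLpNorm : ∀ j n, eLpNorm (fun ω => (θ j n ω : ℂ)) p P = eLpNorm id p ρ := fun j n =>
    (eLpNorm_congr_norm_ae (.of_forall fun ω => Complex.norm_real _)).trans ((hθ j n).eLpNorm_eq p)
  have h_term : ∀ n, eLpNorm (fun ω => (k n : ℂ) * ((θ 0 n ω : ℂ) + Complex.I * θ 1 n ω)) p P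
      ≤ ENNReal.ofReal |k n| * M := fun n => by
    calc _ = ‖(k n : ℂ)‖ₑ * eLpNorm (fun ω => (θ 0 n ω : ℂ) + Complex.I * θ 1 n ω) p P :=
          eLpNorm_const_smul (k n : ℂ) _ p P
      _ ≤ ‖(k n : ℂ)‖ₑ * M := by
          gcongr
          refine (eLpNorm_add_le (h_meas 0 n) ((h_meas 1 n).const_mul _) hp₁).trans_eq ?_
          rw [h_eLpNorm, hM, ← h_eLpNorm 1 n]
          congr 1
          exact eLpNorm_congr_norm_ae (.of_forall fun ω => by simp)
      _ = _ := by
        rw [← ofReal_norm, Complex.norm_real, Real.norm_eq_abs]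
  refine ae_summable_smul_basisVec hp (fun n => ?_) (ne_top_of_le_ne_top ?_
    (ENNReal.tsum_le_tsum fun n => ENNReal.rpow_le_rpow (h_term n) hp₀))
  · exact (((h_meas 0 n).add ((h_meas 1 n).const_mul _)).const_mul _).aemeasurable
  · simp only [ENNReal.mul_rpow_of_nonneg _ _ hp₀, ENNReal.tsum_mul_right,
      ENNReal.ofReal_rpow_of_nonneg (abs_nonneg _) hp₀]
    exact ENNReal.mul_ne_top hk.tsum_ofReal_ne_top (by finiteness [hρ.eLpNorm_ne_top])

theorem aemeasurable_randomSeries [MeasurableSpace (EllP p)] [BorelSpace (EllP p)]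
    (hθ : ∀ j n, AEMeasurable (θ j n) P) (h : ∀ᵐ ω ∂P, Summable (seriesTerm p k θ ω)) :
    AEMeasurable (randomSeries p k θ) P := by
  have h_partial : ∀ N, AEStronglyMeasurable
      (fun ω => ∑ n ∈ Finset.range N, seriesTerm p k θ ω n) P := fun N =>
    Finset.aestronglyMeasurable_fun_sum _ fun n _ => AEStronglyMeasurable.smul_const
      (by have := hθ 0 n; have := hθ 1 n; exact AEMeasurable.aestronglyMeasurable (by fun_prop)) _
  refine (aestronglyMeasurable_of_tendsto_ae atTop h_partial ?_).aemeasurable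
  filter_upwards [h] with ω hω
  exact hω.hasSum.tendsto_sum_nat

/-- The coordinates of `Fin 2 × ℕ → ℝ`, arranged as the double sequence that enters
`randomSeries`. -/
def coordFamily (j : Fin 2) (n : ℕ) (z : Fin 2 × ℕ → ℝ) : ℝ := z (j, n)

theorem identDistrib_coordFamily (ρ : Measure ℝ) [IsProbabilityMeasure ρ] (j : Fin 2) (n : ℕ) :
    IdentDistrib (coordFamily j n) id (Measure.infinitePi fun _ : Fin 2 × ℕ => ρ) ρ where
  aemeasurable_fst := (measurable_pi_apply (j, n)).aemeasurable
  aemeasurable_snd := aemeasurable_id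
  map_eq := (Measure.infinitePi_map_eval (fun _ : Fin 2 × ℕ => ρ) (j, n)).trans
    Measure.map_id.symm

theorem map_randomSeries_eq [MeasurableSpace (EllP p)] [BorelSpace (EllP p)]
    {ρ : Measure ℝ} [IsProbabilityMeasure ρ] (hθi : iIndepFun (fun i : Fin 2 × ℕ => θ i.1 i.2) P)
    (hθ : ∀ j n, IdentDistrib (θ j n) id P ρ)
    (h : AEMeasurable (randomSeries p k coordFamily)
      (Measure.infinitePi fun _ : Fin 2 × ℕ => ρ)) :
    P.map (randomSeries p k θ)
      = (Measure.infinitePi fun _ : Fin 2 × ℕ => ρ).map (randomSeries p k coordFamily) := by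
  have hθm : ∀ i : Fin 2 × ℕ, AEMeasurable (θ i.1 i.2) P := fun i => (hθ _ _).aemeasurable_fst
  have h_joint : P.map (fun ω (i : Fin 2 × ℕ) => θ i.1 i.2 ω)
      = Measure.infinitePi fun _ : Fin 2 × ℕ => ρ := by
    rw [hθi.map_fun_eq_infinitePi_map₀' hθm]
    simp only [(hθ _ _).map_eq, Measure.map_id]
  rw [← h_joint] at h ⊢
  exact (AEMeasurable.map_map_of_aemeasurable h (aemeasurable_pi_lambda _ hθm)).symm

end RandomSeries

section Shift

variable {p : ℝ≥0∞} [Fact (1 ≤ p)] {k w : ℕ → ℝ} {C : ℝ} {hC : 0 ≤ C} {hw : ∀ n, |w n| ≤ C}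

theorem weightedBackwardShift_seriesTerm_succ (hkw : ∀ n, k (n + 1) * w n = k n)
    (z : Fin 2 × ℕ → ℝ) (n : ℕ) :
    weightedBackwardShift p w C hC hw (seriesTerm p k coordFamily z (n + 1))
      = seriesTerm p k coordFamily (coordShift z) n := by
  rw [seriesTerm, map_smul, weightedBackwardShift_basisVec_succ, smul_smul, mul_right_comm,
    ← Complex.ofReal_mul, hkw]
  rfl

theorem weightedBackwardShift_seriesTerm_zero (z : Fin 2 × ℕ → ℝ) :
    weightedBackwardShift p w C hC hw (seriesTerm p k coordFamily z 0) = 0 := by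
  rw [seriesTerm, map_smul, weightedBackwardShift_basisVec_zero, smul_zero]

theorem weightedBackwardShift_randomSeries (hkw : ∀ n, k (n + 1) * w n = k n) {z : Fin 2 × ℕ → ℝ}
    (hz : Summable (seriesTerm p k coordFamily z)) :
    weightedBackwardShift p w C hC hw (randomSeries p k coordFamily z)
      = randomSeries p k coordFamily (coordShift z) := by
  have h_summable : Summable fun n => weightedBackwardShift p w C hC hw
      (seriesTerm p k coordFamily z n) := hz.map _ (ContinuousLinearMap.continuous _)
  rw [randomSeries, ContinuousLinearMap.map_tsum _ hz, h_summable.tsum_eq_zero_add]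
  simp only [weightedBackwardShift_seriesTerm_zero, weightedBackwardShift_seriesTerm_succ hkw,
    zero_add, randomSeries]

theorem isStronglyMixing_weightedBackwardShift [MeasurableSpace (EllP p)] [BorelSpace (EllP p)]
    {Ω : Type*} [MeasurableSpace Ω] {P : Measure Ω} {θ : Fin 2 → ℕ → Ω → ℝ} {ρ : Measure ℝ}
    [IsProbabilityMeasure ρ] (hp : p ≠ ∞) (hk : Summable fun n => |k n| ^ p.toReal)
    (hkw : ∀ n, k (n + 1) * w n = k n) (hρ : MemLp id p ρ)
    (hθi : iIndepFun (fun i : Fin 2 × ℕ => θ i.1 i.2) P)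
    (hθ : ∀ j n, IdentDistrib (θ j n) id P ρ) :
    IsStronglyMixing (weightedBackwardShift p w C hC hw) (P.map (randomSeries p k θ)) := by
  have h_sum := ae_summable_seriesTerm hp hk hρ (identDistrib_coordFamily ρ)
  have h_meas := aemeasurable_randomSeries
    (fun j n => (identDistrib_coordFamily ρ j n).aemeasurable_fst) h_sum
  rw [map_randomSeries_eq hθi hθ h_meas]
  refine isStronglyMixing_coordShift.map (ContinuousLinearMap.continuous _).measurable h_meas ?_
  filter_upwards [h_sum] with z hz
  exact weightedBackwardShift_randomSeries hkw hz

theorem coeff_mul_comp_pow_apply (hkw : ∀ n, k (n + 1) * w n = k n) (y : EllP p →L[ℂ] ℂ)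
    (n j : ℕ) :
    (k (j + n) : ℂ) * (y.comp (weightedBackwardShift p w C hC hw ^ n)) (basisVec p (j + n))
      = (k j : ℂ) * y (basisVec p j) := by
  induction n with
  | zero => simp
  | succ n ih =>
    rw [← ih, pow_succ]
    simp only [ContinuousLinearMap.comp_apply, mul_apply_eq_comp]
    rw [← add_assoc, weightedBackwardShift_basisVec_succ, map_smul, map_smul, smul_eq_mul,
      ← mul_assoc, ← Complex.ofReal_mul, hkw]

theorem weightedBackwardShift_pow_basisVec_of_lt {n m : ℕ} (hm : m < n) :
    (weightedBackwardShift p w C hC hw ^ n) (basisVec p m) = 0 := by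
  induction n generalizing m with
  | zero => exact absurd hm m.not_lt_zero
  | succ n ih =>
    rw [pow_succ, mul_apply_eq_comp]
    cases m with
    | zero => rw [weightedBackwardShift_basisVec_zero, map_zero]
    | succ m =>
      rw [weightedBackwardShift_basisVec_succ, map_smul, ih (Nat.lt_of_succ_lt_succ hm), smul_zero]

end Shift

/-! ### The characteristic functional -/

section RealCharFun

variable {Ω E : Type*} [MeasurableSpace Ω] [MeasurableSpace E] {P : Measure Ω}

theorem realCharFun_map {X : Ω → E} (hX : AEMeasurable X P) {Y : E → ℝ} (hY : Measurable Y)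
    (t : ℝ) : realCharFun (P.map X) Y t = realCharFun P (fun ω => Y (X ω)) t :=
  integral_map hX (Measurable.aestronglyMeasurable (by fun_prop))

theorem realCharFun_eq_charFun_map {Y : Ω → ℝ} (hY : AEMeasurable Y P) (t : ℝ) :
    realCharFun P Y t = charFun (P.map Y) t := by
  rw [charFun_apply_real, integral_map hY (Measurable.aestronglyMeasurable (by fun_prop))]
  refine integral_congr_ae (.of_forall fun ω => ?_)
  push_cast
  ring_nf

theorem realCharFun_sum_mul {ι : Type*} {X : ι → Ω → ℝ} (hX : iIndepFun X P)
    (hXm : ∀ i, AEMeasurable (X i) P) (c : ι → ℝ) (s : Finset ι) (t : ℝ) :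
    realCharFun P (fun ω => ∑ i ∈ s, c i * X i ω) t
      = ∏ i ∈ s, charFun (P.map (X i)) (t * c i) := by
  have h_indep : iIndepFun (fun i ω => c i * X i ω) P :=
    hX.comp (fun i x => c i * x) fun i => measurable_const_mul (c i)
  rw [realCharFun_eq_charFun_map (Finset.aemeasurable_fun_sum _ fun i _ => (hXm i).const_mul _),
    (h_indep.restrict s).charFun_map_fun_finsetSum_eq_prod fun i _ => (hXm i).const_mul _,
    Finset.prod_apply]
  exact Finset.prod_congr rfl fun i _ => by rw [charFun_map_mul_comp (hXm i), mul_comm]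

theorem tendsto_realCharFun_of_tendsto_ae [IsFiniteMeasure P] {Y : ℕ → Ω → ℝ} {Z : Ω → ℝ}
    (hY : ∀ n, AEMeasurable (Y n) P) (h : ∀ᵐ ω ∂P, Tendsto (fun n => Y n ω) atTop (𝓝 (Z ω)))
    (t : ℝ) : Tendsto (fun n => realCharFun P (Y n) t) atTop (𝓝 (realCharFun P Z t)) := by
  have h_cont : Continuous fun r : ℝ => Complex.exp (Complex.I * (t * r : ℝ)) := by fun_prop
  refine tendsto_integral_of_dominated_convergence (fun _ => 1)
    (fun n => h_cont.comp_aestronglyMeasurable (hY n).aestronglyMeasurable) (integrable_const _)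
    (fun n => .of_forall fun ω => (Complex.norm_exp_I_mul_ofReal _).le) ?_
  filter_upwards [h] with ω hω
  exact (h_cont.tendsto _).comp hω

end RealCharFun

section FunctionalLog

open scoped NNReal

variable {p : ℝ≥0∞} [Fact (1 ≤ p)] {k : ℕ → ℝ} {ψ : ℝ → ℂ} {L : ℝ≥0}

theorem summable_norm_mul_apply_basisVec (hp : p ≠ ∞) (hk : Summable fun n => |k n| ^ p.toReal)
    (x : EllP p →L[ℂ] ℂ) : Summable fun n => ‖(k n : ℂ) * x (basisVec p n)‖ := by
  have h := summable_smul_basisVec (p := p) hp (c := fun n => (k n : ℂ))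
    (by simpa only [Complex.norm_real, Real.norm_eq_abs] using hk)
  refine (h.map x x.continuous).norm.congr fun n => ?_
  rw [Function.comp_apply, map_smul, smul_eq_mul]

/-- The coefficients of the real random variables `θ_{1,n}` (index `(0, n)`) and `θ_{2,n}`
(index `(1, n)`) in `Re ⟨∑ k_n (θ_{1,n} + i θ_{2,n}) e_n, x⟩`. -/
noncomputable def functionalFreq (k : ℕ → ℝ) (x : EllP p →L[ℂ] ℂ) (i : Fin 2 × ℕ) : ℝ :=
  if i.1 = 0 then ((k i.2 : ℂ) * x (basisVec p i.2)).re
  else -((k i.2 : ℂ) * x (basisVec p i.2)).im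

theorem abs_functionalFreq_le (x : EllP p →L[ℂ] ℂ) (i : Fin 2 × ℕ) :
    |functionalFreq k x i| ≤ ‖(k i.2 : ℂ) * x (basisVec p i.2)‖ := by
  unfold functionalFreq
  split_ifs
  · exact Complex.abs_re_le_norm _
  · exact (abs_neg _).trans_le (Complex.abs_im_le_norm _)

theorem functionalFreq_sub (x y : EllP p →L[ℂ] ℂ) (i : Fin 2 × ℕ) :
    functionalFreq k (x - y) i = functionalFreq k x i - functionalFreq k y i := by
  simp only [functionalFreq, sub_apply, mul_sub, Complex.sub_re,
    Complex.sub_im]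
  split_ifs <;> ring

theorem functionalFreq_neg (y : EllP p →L[ℂ] ℂ) (i : Fin 2 × ℕ) :
    functionalFreq k (-y) i = -functionalFreq k y i := by
  simp only [functionalFreq, neg_apply, mul_neg, Complex.neg_re,
    Complex.neg_im]
  split_ifs <;> rfl

theorem re_apply_seriesTerm {Ω : Type*} (θ : Fin 2 → ℕ → Ω → ℝ) (x : EllP p →L[ℂ] ℂ) (ω : Ω)
    (n : ℕ) : (x (seriesTerm p k θ ω n)).re = ∑ j, functionalFreq k x (j, n) * θ j n ω := by
  have h_apply : x (seriesTerm p k θ ω n) = (θ 0 n ω : ℂ) * ((k n : ℂ) * x (basisVec p n))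
      + (θ 1 n ω : ℂ) * (Complex.I * ((k n : ℂ) * x (basisVec p n))) := by
    rw [seriesTerm, map_smul, smul_eq_mul]
    ring
  rw [h_apply, Complex.add_re, Complex.re_ofReal_mul (θ 0 n ω), Complex.re_ofReal_mul (θ 1 n ω),
    Complex.I_mul_re, Fin.sum_univ_two, mul_comm (θ 0 n ω), mul_comm (θ 1 n ω)]
  rfl

/-- The distinguished logarithm of the characteristic function of `Re ⟨·, x⟩` under the law of
`∑ k_n (θ_{1,n} + i θ_{2,n}) e_n`, when the `θ_{j,n}` are independent with characteristic function
`exp ψ`. -/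
noncomputable def functionalLog (ψ : ℝ → ℂ) (k : ℕ → ℝ) (x : EllP p →L[ℂ] ℂ) (t : ℝ) : ℂ :=
  ∑' n, ∑ j, ψ (t * functionalFreq k x (j, n))

theorem norm_functionalLog_term_sub_le (hψ : LipschitzWith L ψ) (x : EllP p →L[ℂ] ℂ) (s t : ℝ)
    (n : ℕ) :
    ‖∑ j, ψ (s * functionalFreq k x (j, n)) - ∑ j, ψ (t * functionalFreq k x (j, n))‖
      ≤ 2 * L * |s - t| * ‖(k n : ℂ) * x (basisVec p n)‖ := by
  rw [← Finset.sum_sub_distrib]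
  calc _ ≤ ∑ _j : Fin 2, L * (|s - t| * ‖(k n : ℂ) * x (basisVec p n)‖) := by
        refine norm_sum_le_of_le _ fun j _ => (hψ.norm_sub_le _ _).trans ?_
        rw [← sub_mul, norm_mul, Real.norm_eq_abs]
        gcongr
        exact abs_functionalFreq_le x (j, n)
    _ = _ := by
        rw [Fin.sum_const, nsmul_eq_mul]
        push_cast
        ring

theorem summable_functionalLog (hψ : LipschitzWith L ψ) (hψ₀ : ψ 0 = 0) (hp : p ≠ ∞)
    (hk : Summable fun n => |k n| ^ p.toReal) (x : EllP p →L[ℂ] ℂ) (t : ℝ) :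
    Summable fun n => ∑ j, ψ (t * functionalFreq k x (j, n)) := by
  refine Summable.of_norm_bounded
    ((summable_norm_mul_apply_basisVec hp hk x).mul_left (2 * L * |t|)) fun n => ?_
  simpa [hψ₀] using norm_functionalLog_term_sub_le hψ x t 0 n

theorem continuous_functionalLog (hψ : LipschitzWith L ψ) (hψ₀ : ψ 0 = 0) (hp : p ≠ ∞)
    (hk : Summable fun n => |k n| ^ p.toReal) (x : EllP p →L[ℂ] ℂ) :
    Continuous (functionalLog ψ k x) := by
  have h_summable := summable_functionalLog hψ hψ₀ hp hk x
  refine (LipschitzWith.of_dist_le' (K := 2 * L * ∑' n, ‖(k n : ℂ) * x (basisVec p n)‖)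
    fun s t => ?_).continuous
  rw [dist_eq_norm, Real.dist_eq, functionalLog, functionalLog,
    ← (h_summable s).tsum_sub (h_summable t), mul_right_comm, ← tsum_mul_left]
  exact tsum_of_norm_bounded ((summable_norm_mul_apply_basisVec hp hk x).mul_left _).hasSum
    fun n => norm_functionalLog_term_sub_le hψ x s t n

theorem norm_functionalLog_codifference_le (hψ : LipschitzWith L ψ) (hψ₀ : ψ 0 = 0) (hp : p ≠ ∞)
    (hk : Summable fun n => |k n| ^ p.toReal) {D q R : ℝ} (hq : 0 ≤ q)
    (hψ_cod : ∀ s t, ‖ψ (s - t) - ψ s - ψ (-t)‖ ≤ D * (|s| ^ q * |t| ^ q))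
    (x y : EllP p →L[ℂ] ℂ)
    (hR : ∀ N, ∑ n ∈ Finset.range N, ‖(k n : ℂ) * x (basisVec p n)‖ ^ q
      * ‖(k n : ℂ) * y (basisVec p n)‖ ^ q ≤ R) :
    ‖functionalLog ψ k (x - y) 1 - functionalLog ψ k x 1 - functionalLog ψ k (-y) 1‖
      ≤ 2 * D * R := by
  have hD : 0 ≤ D := by simpa using (norm_nonneg _).trans (hψ_cod 1 1)
  have h_hasSum := fun x => (summable_functionalLog hψ hψ₀ hp hk x 1).hasSum
  have h_term : ∀ n, ‖∑ j, ψ (1 * functionalFreq k (x - y) (j, n))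
      - ∑ j, ψ (1 * functionalFreq k x (j, n)) - ∑ j, ψ (1 * functionalFreq k (-y) (j, n))‖
      ≤ 2 * D * (‖(k n : ℂ) * x (basisVec p n)‖ ^ q * ‖(k n : ℂ) * y (basisVec p n)‖ ^ q) :=
    fun n => by
    simp only [one_mul, functionalFreq_sub, functionalFreq_neg, ← Finset.sum_sub_distrib]
    calc _ ≤ ∑ _j : Fin 2, D * (‖(k n : ℂ) * x (basisVec p n)‖ ^ q
          * ‖(k n : ℂ) * y (basisVec p n)‖ ^ q) := by
          refine norm_sum_le_of_le _ fun j _ => (hψ_cod _ _).trans ?_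
          gcongr
          · exact abs_functionalFreq_le x (j, n)
          · exact abs_functionalFreq_le y (j, n)
      _ = _ := by
          rw [Fin.sum_const, nsmul_eq_mul]
          push_cast
          ring
  refine le_of_tendsto
    (((h_hasSum (x - y)).sub (h_hasSum x)).sub (h_hasSum (-y))).tendsto_sum_nat.norm
    (.of_forall fun N => (norm_sum_le_of_le _ fun n _ => h_term n).trans ?_)
  rw [← Finset.mul_sum]
  gcongr
  exact hR N

variable {Ω : Type*} [MeasurableSpace Ω] {P : Measure Ω} {θ : Fin 2 → ℕ → Ω → ℝ}
  [MeasurableSpace (EllP p)] [BorelSpace (EllP p)]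

theorem realCharFun_map_randomSeries (hψ : LipschitzWith L ψ) (hψ₀ : ψ 0 = 0) (hp : p ≠ ∞)
    (hk : Summable fun n => |k n| ^ p.toReal)
    (hθi : iIndepFun (fun i : Fin 2 × ℕ => θ i.1 i.2) P) (hθm : ∀ j n, AEMeasurable (θ j n) P)
    (hθ : ∀ j n t, charFun (P.map (θ j n)) t = Complex.exp (ψ t))
    (hsum : ∀ᵐ ω ∂P, Summable (seriesTerm p k θ ω)) (x : EllP p →L[ℂ] ℂ) (t : ℝ) :
    realCharFun (P.map (randomSeries p k θ)) (fun z => (x z).re) t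
      = Complex.exp (functionalLog ψ k x t) := by
  have : IsProbabilityMeasure P := hθi.isProbabilityMeasure
  let Y : ℕ → Ω → ℝ := fun N ω => ∑ n ∈ Finset.range N, ∑ j, functionalFreq k x (j, n) * θ j n ω
  have h_partial : ∀ N, realCharFun P (Y N) t
      = Complex.exp (∑ n ∈ Finset.range N, ∑ j, ψ (t * functionalFreq k x (j, n))) := fun N => by
    have h := realCharFun_sum_mul hθi (fun i => hθm i.1 i.2) (functionalFreq k x)
      (Finset.univ ×ˢ Finset.range N) t
    simpa only [hθ, ← Complex.exp_sum, Finset.sum_product_right] using h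
  have h_tendsto : ∀ᵐ ω ∂P, Tendsto (fun N => Y N ω) atTop
      (𝓝 (x (randomSeries p k θ ω)).re) := by
    filter_upwards [hsum] with ω hω
    simp only [Y, ← re_apply_seriesTerm]
    exact (hω.hasSum.mapL (Complex.reCLM.comp (x.restrictScalars ℝ))).tendsto_sum_nat
  rw [realCharFun_map (aemeasurable_randomSeries hθm hsum) (Continuous.measurable (by fun_prop))]
  refine tendsto_nhds_unique (tendsto_realCharFun_of_tendsto_ae (fun N => ?_) h_tendsto t) ?_
  · exact Finset.aemeasurable_fun_sum _ fun n _ => Finset.aemeasurable_fun_sum _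
      fun j _ => (hθm j n).const_mul _
  · simp only [h_partial]
    exact (Complex.continuous_exp.tendsto _).comp
      (summable_functionalLog hψ hψ₀ hp hk x t).hasSum.tendsto_sum_nat

theorem isDistinguishedLog_functionalLog (hψ : LipschitzWith L ψ) (hψ₀ : ψ 0 = 0) (hp : p ≠ ∞)
    (hk : Summable fun n => |k n| ^ p.toReal)
    (hθi : iIndepFun (fun i : Fin 2 × ℕ => θ i.1 i.2) P) (hθm : ∀ j n, AEMeasurable (θ j n) P)
    (hθ : ∀ j n t, charFun (P.map (θ j n)) t = Complex.exp (ψ t))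
    (hsum : ∀ᵐ ω ∂P, Summable (seriesTerm p k θ ω)) (x : EllP p →L[ℂ] ℂ) :
    IsDistinguishedLog (realCharFun (P.map (randomSeries p k θ)) fun z => (x z).re)
      (functionalLog ψ k x) :=
  ⟨continuous_functionalLog hψ hψ₀ hp hk x, by simp [functionalLog, hψ₀],
    fun t => (realCharFun_map_randomSeries hψ hψ₀ hp hk hθi hθm hθ hsum x t).symm⟩

end FunctionalLog

theorem codifference_eq_of_isDistinguishedLog {E : Type*} [NormedAddCommGroup E]
    [NormedSpace ℂ E] [MeasurableSpace E] {μ : Measure E} {Ψ : (E →L[ℂ] ℂ) → ℝ → ℂ}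
    (hΨ : ∀ x : E →L[ℂ] ℂ, IsDistinguishedLog (realCharFun μ fun z => (x z).re) (Ψ x))
    (x y : E →L[ℂ] ℂ) : codifference μ x y = Ψ (x - y) 1 - Ψ x 1 - Ψ (-y) 1 := by
  have h_log : ∀ x : E →L[ℂ] ℂ, logIntegralExp μ (fun z => (x z).re) = Ψ x 1 := fun x => by
    rw [logIntegralExp, distinguishedLog_eq (hΨ x)]
  have h_neg : (fun z => -(y z).re) = fun z => ((-y) z).re := rfl
  rw [codifference, h_neg, h_log, h_log, h_log]

/-! ### Decay of the codifference -/

section Decay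

open scoped NNReal

variable {p : ℝ≥0∞} [Fact (1 ≤ p)] {k : ℕ → ℝ}

theorem norm_mul_apply_basisVec_rpow_le {q : ℝ} (hq : 0 ≤ q) (x : EllP p →L[ℂ] ℂ) (n : ℕ) :
    ‖(k n : ℂ) * x (basisVec p n)‖ ^ q ≤ |k n| ^ q * ‖x‖ ^ q := by
  rw [← Real.mul_rpow (abs_nonneg _) (norm_nonneg _), norm_mul, Complex.norm_real,
    Real.norm_eq_abs]
  gcongr
  simpa only [norm_basisVec, mul_one] using x.le_opNorm (basisVec p n)

theorem sum_norm_rpow_mul_norm_rpow_comp_pow_le {w : ℕ → ℝ} {C : ℝ} {hC : 0 ≤ C}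
    {hw : ∀ n, |w n| ≤ C} (hkw : ∀ n, k (n + 1) * w n = k n) {q R : ℝ} (hq : 0 < q)
    (x y : EllP p →L[ℂ] ℂ) (n : ℕ)
    (hR : ∀ N, ∑ j ∈ Finset.range N, |k j| ^ q * |k (j + n)| ^ q ≤ R) (N : ℕ) :
    ∑ m ∈ Finset.range N, ‖(k m : ℂ) * x (basisVec p m)‖ ^ q
      * ‖(k m : ℂ) * (y.comp (weightedBackwardShift p w C hC hw ^ n)) (basisVec p m)‖ ^ q
      ≤ R * (‖x‖ ^ q * ‖y‖ ^ q) := by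
  set f : ℕ → ℝ := fun m => ‖(k m : ℂ) * x (basisVec p m)‖ ^ q
    * ‖(k m : ℂ) * (y.comp (weightedBackwardShift p w C hC hw ^ n)) (basisVec p m)‖ ^ q
  have h_zero : ∀ m < n, f m = 0 := fun m hm => by
    simp only [f, ContinuousLinearMap.comp_apply, weightedBackwardShift_pow_basisVec_of_lt hm,
      map_zero, mul_zero, norm_zero, Real.zero_rpow hq.ne']
  have h_shift : ∀ j, f (j + n) ≤ |k j| ^ q * |k (j + n)| ^ q * (‖x‖ ^ q * ‖y‖ ^ q) := fun j => by
    simp only [f, coeff_mul_comp_pow_apply hkw]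
    calc _ ≤ (|k (j + n)| ^ q * ‖x‖ ^ q) * (|k j| ^ q * ‖y‖ ^ q) := by
          gcongr <;> exact norm_mul_apply_basisVec_rpow_le hq.le _ _
      _ = _ := by ring
  calc ∑ m ∈ Finset.range N, f m ≤ ∑ m ∈ Finset.range (n + N), f m :=
        Finset.sum_le_sum_of_subset_of_nonneg
          (Finset.range_mono (Nat.le_add_left N n)) fun m _ _ => by positivity
    _ = ∑ j ∈ Finset.range N, f (j + n) := by
        rw [Finset.sum_range_add,
          Finset.sum_eq_zero fun m hm => h_zero m (Finset.mem_range.1 hm), zero_add]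
        simp only [add_comm n]
    _ ≤ (∑ j ∈ Finset.range N, |k j| ^ q * |k (j + n)| ^ q) * (‖x‖ ^ q * ‖y‖ ^ q) := by
        rw [Finset.sum_mul]
        exact Finset.sum_le_sum fun j _ => h_shift j
    _ ≤ _ := by
        gcongr
        exact hR N

theorem sum_shiftCoeff_rpow_mul_le {γ γ' q k₀ : ℝ} (hq : q ≠ 0) (hk₀ : 0 < k₀) (h₁ : 1 < γ')
    (h₂ : γ' < 2) (hγ : γ' ≤ γ) {n : ℕ} (hn : 1 ≤ n) (N : ℕ) :
    ∑ j ∈ Finset.range N, |shiftCoeff γ q k₀ j| ^ (q / 2) * |shiftCoeff γ q k₀ (j + n)| ^ (q / 2)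
      ≤ k₀ ^ q * (beta (1 - γ' / 2) (γ' - 1) * (n : ℝ) ^ (-(γ' - 1))) := by
  have h_coeff : ∀ m : ℕ, |shiftCoeff γ q k₀ m| ^ (q / 2)
      ≤ k₀ ^ (q / 2) * ((m : ℝ) + 1) ^ (-(γ' / 2)) := fun m => by
    rw [abs_of_pos (shiftCoeff_pos hk₀ m), shiftCoeff_rpow hk₀.le]
    gcongr
    · exact le_add_of_nonneg_left m.cast_nonneg
    · rw [neg_mul, neg_le_neg_iff, div_mul_div_cancel₀ hq]
      linarith
  have h_beta := sum_rpow_mul_add_rpow_le_beta (a := 1 - γ' / 2) (b := γ' - 1) (c := n)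
    (by linarith) (by linarith) (by linarith) (by exact_mod_cast hn) N
  rw [show 1 - γ' / 2 - 1 = -(γ' / 2) by ring,
    show -(1 - γ' / 2 + (γ' - 1)) = -(γ' / 2) by ring] at h_beta
  calc _ ≤ ∑ j ∈ Finset.range N, k₀ ^ (q / 2) * ((j : ℝ) + 1) ^ (-(γ' / 2))
        * (k₀ ^ (q / 2) * (((j + n : ℕ) : ℝ) + 1) ^ (-(γ' / 2))) := by
        gcongr <;> exact h_coeff _
    _ = k₀ ^ q * ∑ j ∈ Finset.range N,
        ((j : ℝ) + 1) ^ (-(γ' / 2)) * ((j : ℝ) + 1 + n) ^ (-(γ' / 2)) := by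
        rw [Finset.mul_sum]
        refine Finset.sum_congr rfl fun j _ => ?_
        rw [mul_mul_mul_comm, ← Real.rpow_add hk₀, add_halves, Nat.cast_add, add_right_comm]
    _ ≤ _ := by
        rw [mul_comm (beta _ _)]
        gcongr

theorem norm_codifference_powerShift_le {ψ : ℝ → ℂ} {L : ℝ≥0} {D γ γ' k₀ : ℝ} (hp : p ≠ ∞)
    (hγ : 1 < γ) (hk₀ : 0 < k₀) (hψ : LipschitzWith L ψ) (hψ₀ : ψ 0 = 0)
    (hψ_cod : ∀ s t,
      ‖ψ (s - t) - ψ s - ψ (-t)‖ ≤ D * (|s| ^ (p.toReal / 2) * |t| ^ (p.toReal / 2)))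
    [MeasurableSpace (EllP p)] {μ : Measure (EllP p)}
    (hμ : ∀ x : EllP p →L[ℂ] ℂ, IsDistinguishedLog (realCharFun μ fun z => (x z).re)
      (functionalLog ψ (shiftCoeff γ p.toReal k₀) x))
    (h₁ : 1 < γ') (h₂ : γ' < 2) (hγ' : γ' ≤ γ) {n : ℕ} (hn : 1 ≤ n) (x y : EllP p →L[ℂ] ℂ) :
    ‖codifference μ x (y.comp (powerShift p γ hγ ^ n))‖
      ≤ 2 * D * k₀ ^ p.toReal * beta (1 - γ' / 2) (γ' - 1) * (n : ℝ) ^ (-(γ' - 1))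
        * (‖x‖ ^ (p.toReal / 2) * ‖y‖ ^ (p.toReal / 2)) := by
  have hq : 0 < p.toReal := ENNReal.toReal_pos (zero_lt_one.trans_le Fact.out).ne' hp
  rw [codifference_eq_of_isDistinguishedLog hμ]
  refine (norm_functionalLog_codifference_le hψ hψ₀ hp (summable_shiftCoeff_rpow hk₀ hq hγ)
    (half_pos hq).le hψ_cod x _ (sum_norm_rpow_mul_norm_rpow_comp_pow_le shiftCoeff_succ_mul
      (half_pos hq) x y n (sum_shiftCoeff_rpow_mul_le hq.ne' hk₀ h₁ h₂ hγ' hn))).trans_eq ?_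
  ring

theorem norm_codifference_powerShift_div_le {ψ : ℝ → ℂ} {L : ℝ≥0} {D K γ γ' k₀ : ℝ} (hp : p ≠ ∞)
    (hγ : 1 < γ) (hk₀ : 0 < k₀) (hψ : LipschitzWith L ψ) (hψ₀ : ψ 0 = 0)
    (hψ_cod : ∀ s t,
      ‖ψ (s - t) - ψ s - ψ (-t)‖ ≤ D * (|s| ^ (p.toReal / 2) * |t| ^ (p.toReal / 2)))
    [MeasurableSpace (EllP p)] {μ : Measure (EllP p)}
    (hμ : ∀ x : EllP p →L[ℂ] ℂ, IsDistinguishedLog (realCharFun μ fun z => (x z).re)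
      (functionalLog ψ (shiftCoeff γ p.toReal k₀) x))
    (hK : 2 * D * k₀ ^ p.toReal ≤ K) (h₁ : 1 < γ') (h₂ : γ' < 2) (hγ' : γ' ≤ γ) {n : ℕ}
    (hn : 1 ≤ n) (x y : EllP p →L[ℂ] ℂ) :
    ‖codifference μ x (y.comp (powerShift p γ hγ ^ n))‖
        / (‖x‖ ^ (p.toReal / 2) * ‖y‖ ^ (p.toReal / 2))
      ≤ K * beta (1 - γ' / 2) (γ' - 1) * (n : ℝ) ^ (-(γ' - 1)) := by
  have h_beta : 0 < beta (1 - γ' / 2) (γ' - 1) := beta_pos (by linarith) (by linarith)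
  have hD : 0 ≤ D := by simpa using (norm_nonneg _).trans (hψ_cod 1 1)
  have hK₀ : 0 ≤ K := hK.trans' (by positivity)
  refine div_le_of_le_mul₀ (by positivity) (by positivity)
    ((norm_codifference_powerShift_le hp hγ hk₀ hψ hψ₀ hψ_cod hμ h₁ h₂ hγ' hn x y).trans ?_)
  gcongr

end Decay

section LevyNoise

variable {ν : Measure ℝ}

theorem HasLevyMeasure.identDistrib {Ω : Type*} [MeasurableSpace Ω] {P : Measure Ω} {X : Ω → ℝ}
    {ρ : Measure ℝ} (hX : HasLevyMeasure (P.map X) ν) (hρ : HasLevyMeasure ρ ν) :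
    IdentDistrib X id P ρ := by
  have := hX.1
  have := hρ.1
  refine ⟨.of_map_ne_zero (IsProbabilityMeasure.ne_zero _), aemeasurable_id, ?_⟩
  rw [Measure.map_id]
  exact Measure.ext_of_charFun (funext fun t => (hX.2 t).trans (hρ.2 t).symm)

theorem integrable_abs_rpow_of_mem_Icc (hν : Integrable (fun x : ℝ => |x|) ν)
    (hν₂ : Integrable (fun x : ℝ => x ^ 2) ν) {q : ℝ} (hq : q ∈ Set.Icc 1 2) :
    Integrable (fun x : ℝ => |x| ^ q) ν := by
  refine (hν.add hν₂).mono' (Measurable.aestronglyMeasurable (by fun_prop))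
    (.of_forall fun x => ?_)
  rw [Real.norm_of_nonneg (by positivity), Pi.add_apply, ← sq_abs x]
  rcases le_total |x| 1 with h | h
  · exact (Real.rpow_le_self_of_le_one (abs_nonneg x) h hq.1).trans
      (le_add_of_nonneg_right (sq_nonneg _))
  · refine (Real.rpow_le_rpow_of_exponent_le h hq.2).trans ?_
    rw [Real.rpow_two]
    exact le_add_of_nonneg_left (abs_nonneg x)

end LevyNoise

theorem one_le_toReal_of_fact {p : ℝ≥0∞} [Fact (1 ≤ p)] (hp : p ≠ ∞) : 1 ≤ p.toReal := by
  simpa only [ENNReal.toReal_one] using ENNReal.toReal_mono hp (Fact.out : 1 ≤ p)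

theorem mainTheorem9_general {Ω : Type*} [MeasurableSpace Ω] {P : Measure Ω}
    {p : ℝ≥0∞} [Fact (1 ≤ p)] (hp : p ≤ 2) [MeasurableSpace (EllP p)] [BorelSpace (EllP p)]
    {ν : Measure ℝ} (hν : Integrable (fun x : ℝ => |x|) ν)
    (hν₂ : Integrable (fun x : ℝ => x ^ 2) ν) {γ k₀ : ℝ} (hγ : 1 < γ) (hk₀ : 0 < k₀)
    {θ : Fin 2 → ℕ → Ω → ℝ} (hθi : iIndepFun (fun i : Fin 2 × ℕ => θ i.1 i.2) P)
    (hθ : ∀ j n, HasLevyMeasure (P.map (θ j n)) ν) {X : Ω → EllP p}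
    (hX : X = randomSeries p (shiftCoeff γ p.toReal k₀) θ) {μ : Measure (EllP p)}
    (hμ : μ = P.map X) {T : EllP p →L[ℂ] EllP p} (hT : T = powerShift p γ hγ) {K : ℝ}
    (hK : 2 ^ (3 - p.toReal) * (∫ x, |x| ^ p.toReal ∂ν) * k₀ ^ p.toReal ≤ K) :
    (∀ᵐ ω ∂P, Summable (seriesTerm p (shiftCoeff γ p.toReal k₀) θ ω)) ∧
    AEMeasurable X P ∧
    IsProbabilityMeasure μ ∧
    MeasurePreserving T μ μ ∧
    IsStronglyMixing T μ ∧
    (∀ x : EllP p →L[ℂ] ℂ, ∃ ψ, IsDistinguishedLog (realCharFun μ (fun z => (x z).re)) ψ) ∧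
    (γ < 2 → ∀ n : ℕ, 1 ≤ n → ∀ x y : EllP p →L[ℂ] ℂ, x ≠ 0 → y ≠ 0 →
      ‖codifference μ x (y.comp (T ^ n))‖ / (‖x‖ ^ (p.toReal / 2) * ‖y‖ ^ (p.toReal / 2))
        ≤ K * beta (1 - γ / 2) (γ - 1) * (n : ℝ) ^ (-(γ - 1))) ∧
    (2 ≤ γ → ∀ ε : ℝ, 0 < ε → ε < 1 →
      ∀ n : ℕ, 1 ≤ n → ∀ x y : EllP p →L[ℂ] ℂ, x ≠ 0 → y ≠ 0 →
      ‖codifference μ x (y.comp (T ^ n))‖ / (‖x‖ ^ (p.toReal / 2) * ‖y‖ ^ (p.toReal / 2))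
        ≤ K * beta (ε / 2) (1 - ε) * (n : ℝ) ^ (-(1 - ε))) := by
  subst hX hμ hT
  have hp_top : p ≠ ∞ := ne_top_of_le_ne_top ENNReal.ofNat_ne_top hp
  have hp₁ := one_le_toReal_of_fact hp_top
  have hp₂ : p.toReal ≤ 2 := by simpa using ENNReal.toReal_mono ENNReal.ofNat_ne_top hp
  have := hθi.isProbabilityMeasure
  have := (hθ 0 0).1
  have hk := summable_shiftCoeff_rpow hk₀ (zero_lt_one.trans_le hp₁) hγ
  have h_ident := fun j n => (hθ j n).identDistrib (hθ 0 0)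
  have h_memLp : MemLp id p (P.map (θ 0 0)) := ((hθ 0 0).memLp_two hν hν₂).mono_exponent hp
  have h_sum := ae_summable_seriesTerm hp_top hk h_memLp h_ident
  have hθm := fun j n => (h_ident j n).aemeasurable_fst
  have hX := aemeasurable_randomSeries hθm h_sum
  have h_mixing : IsStronglyMixing (powerShift p γ hγ) _ :=
    isStronglyMixing_weightedBackwardShift hp_top hk shiftCoeff_succ_mul h_memLp hθi h_ident
  have hψ := lipschitzWith_levyExponent hν
  have h_log := isDistinguishedLog_functionalLog hψ levyExponent_zero hp_top hk hθi hθm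
    (fun j n => (hθ j n).2) h_sum
  have h_cod := norm_levyExponent_codifference_le hν (zero_le_one.trans hp₁) hp₂
    (integrable_abs_rpow_of_mem_Icc hν hν₂ ⟨hp₁, hp₂⟩)
  have h_const : 2 * (2 ^ (2 - p.toReal) * ∫ x, |x| ^ p.toReal ∂ν) * k₀ ^ p.toReal ≤ K := by
    rwa [← mul_assoc, ← Real.rpow_one_add' zero_le_two (by linarith),
      show 1 + (2 - p.toReal) = 3 - p.toReal by ring]
  have h_decay := fun γ' (h₁ : 1 < γ') (h₂ : γ' < 2) (hγ' : γ' ≤ γ) n (hn : 1 ≤ n) =>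
    norm_codifference_powerShift_div_le hp_top hγ hk₀ hψ levyExponent_zero h_cod h_log h_const
      h₁ h₂ hγ' hn
  refine ⟨h_sum, hX, Measure.isProbabilityMeasure_map hX, h_mixing.1, h_mixing,
    fun x => ⟨_, h_log x⟩, fun hγ₂ n hn x y _ _ => h_decay γ hγ hγ₂ le_rfl n hn x y,
    fun hγ₂ ε hε₀ hε₁ n hn x y _ _ => ?_⟩
  have h := h_decay (2 - ε) (by linarith) (by linarith) (by linarith) n hn x y
  rwa [show 1 - (2 - ε) / 2 = ε / 2 by ring, show 2 - ε - 1 = 1 - ε by ring] at h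

theorem mainTheorem9 {Ω : Type*} [MeasurableSpace Ω] (P : Measure Ω) [IsProbabilityMeasure P]
    (p : ℝ≥0∞) [Fact (1 ≤ p)] (hp : p ≤ 2)
    [MeasurableSpace (EllP p)] [BorelSpace (EllP p)]
    (α aₙ aₚ lₙ lₚ γ k₀ : ℝ) (hα₀ : 0 < α) (hα₁ : α < 1)
    (haₙ : 0 < aₙ) (haₚ : 0 < aₚ) (hlₙ : 0 < lₙ) (hlₚ : 0 < lₚ)
    (hγ : 1 < γ) (hk₀ : 0 < k₀)
    (θ : Fin 2 → ℕ → Ω → ℝ) (hθm : ∀ j n, Measurable (θ j n))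
    (hθi : iIndepFun (fun i : Fin 2 × ℕ => θ i.1 i.2) P)
    (hθ : ∀ j n, IsTemperedStable α aₙ aₚ lₙ lₚ (P.map (θ j n)))
    (X : Ω → EllP p) (hX : X = randomSeries p (shiftCoeff γ p.toReal k₀) θ)
    (μ : Measure (EllP p)) (hμ : μ = P.map X)
    (T : EllP p →L[ℂ] EllP p) (hT : T = powerShift p γ hγ)
    (K : ℝ) (hK : K = (2 : ℝ) ^ (5 - p.toReal)
      * (aₙ * lₙ ^ (α - p.toReal) + aₚ * lₚ ^ (α - p.toReal))
      * Real.Gamma (p.toReal - α) * k₀ ^ p.toReal) :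
    -- the series defining `μ` converges almost surely in `ℓ^p(ℕ)`
    (∀ᵐ ω ∂P, Summable (seriesTerm p (shiftCoeff γ p.toReal k₀) θ ω)) ∧
    AEMeasurable X P ∧
    -- `μ` is an invariant probability measure and `T` is mixing
    IsProbabilityMeasure μ ∧
    MeasurePreserving T μ μ ∧
    IsStronglyMixing T μ ∧
    -- the logarithms in the codifference exist
    (∀ x : EllP p →L[ℂ] ℂ, ∃ ψ, IsDistinguishedLog (realCharFun μ (fun z => (x z).re)) ψ) ∧
    -- decay of the normalized codifference; `T^{*n} y^* = y^* ∘ T^n`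
    (γ < 2 → ∀ n : ℕ, 1 ≤ n → ∀ x y : EllP p →L[ℂ] ℂ, x ≠ 0 → y ≠ 0 →
      ‖codifference μ x (y.comp (T ^ n))‖ / (‖x‖ ^ (p.toReal / 2) * ‖y‖ ^ (p.toReal / 2))
        ≤ K * ProbabilityTheory.beta (1 - γ / 2) (γ - 1) * (n : ℝ) ^ (-(γ - 1))) ∧
    (2 ≤ γ → ∀ ε : ℝ, 0 < ε → ε < 1 →
      ∀ n : ℕ, 1 ≤ n → ∀ x y : EllP p →L[ℂ] ℂ, x ≠ 0 → y ≠ 0 →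
      ‖codifference μ x (y.comp (T ^ n))‖ / (‖x‖ ^ (p.toReal / 2) * ‖y‖ ^ (p.toReal / 2))
        ≤ K * ProbabilityTheory.beta (ε / 2) (1 - ε) * (n : ℝ) ^ (-(1 - ε))) := by
  refine mainTheorem9_general hp
    (integrable_abs_temperedLevyMeasure haₙ.le haₚ.le hlₙ hlₚ hα₁)
    (integrable_sq_temperedLevyMeasure haₙ.le haₚ.le hlₙ hlₚ (hα₁.trans one_lt_two))
    hγ hk₀ hθi hθ hX hμ hT ?_
  have hp₁ := one_le_toReal_of_fact (ne_top_of_le_ne_top ENNReal.ofNat_ne_top hp)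
  have hΓ := Real.Gamma_pos_of_pos (sub_pos.2 (hα₁.trans_le hp₁))
  rw [hK, integral_abs_rpow_temperedLevyMeasure haₙ.le haₚ.le hlₙ hlₚ (hα₁.trans_le hp₁),
    ← mul_assoc]
  gcongr <;> norm_num
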